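/- Let $N\ge 1$ be an integer, and let $p,q$ be integers with $q\neq 0$ and $p^{2}\equiv 1 \pmod q$ such that the rational number $p/q$ is $\Gamma_0(N)$-equivalent to $i\infty$, i.e. $\gamma(i\infty)=p/q$ for some $\gamma\in\Gamma_0(N)$. Let $k$ be an integer and let $f(z)=\sum_{n\ge 1}a_f(n)e^{2\pi i n z}\in S_k(\Gamma_0(N))$ be a cusp form of weight $k$ whose Fourier coefficients $a_f(n)$ are all real or all purely imaginary. Let $$L_{p/q}(s,f)=\sum_{n=1}^{\infty}\frac{a_f(n)\,e^{2\pi i n p/q}}{n^{s}},$$ a Dirichlet series that converges absolutely for $\operatorname{Re}(s)$ sufficiently large and continues to an entire function of $s$, denoted in the same way. For $T>0$ let $\mathcal N_{0,p/q}(T)\in\mathbb{N}\cup\{\infty\}$ be the number of distinct zeros of $L_{p/q}(s,f)$ of the form $s=\frac k2+it$ with $0\le t\le T$ (for $f=0$ this number is $\infty$). Then there exists $d>0$ such that $$\liminf_{T\to\infty}\frac{\mathcal N_{0,p/q}(T)}{T}>d .$$ -/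

import Mathlib

open scoped MatrixGroups

/-- The subgroup of `GL(2, ℝ)` given by the Hecke congruence subgroup `Γ₀(N)`. -/
abbrev Gamma0GL (N : ℕ) : Subgroup (GL (Fin 2) ℝ) :=
  (CongruenceSubgroup.Gamma0 N).map (Matrix.SpecialLinearGroup.mapGL ℝ)

/-- The rational number `x` is `Γ₀(N)`-equivalent to the cusp `i∞`: some `γ ∈ Γ₀(N)` satisfies
`γ ∞ = x`, for the action by Möbius transformations on `ℙ¹(ℚ) = ℚ ∪ {∞}`. -/
def IsGamma0EquivInfty (N : ℕ) (x : ℚ) : Prop :=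
  ∃ γ ∈ CongruenceSubgroup.Gamma0 N,
    Matrix.SpecialLinearGroup.mapGL ℚ γ • (OnePoint.infty : OnePoint ℚ) = (x : OnePoint ℚ)

/-- The `n`-th Fourier coefficient `a_f(n)`, where `f(z) = ∑ a_f(n) exp(2πinz)`. -/
noncomputable def cuspFourierCoeff {N : ℕ} {k : ℤ} (f : CuspForm (Gamma0GL N) k) (n : ℕ) : ℂ :=
  (UpperHalfPlane.qExpansion 1 f).coeff n

/-- The additively twisted coefficient `a_f(n) exp(2πixn)`. -/
noncomputable def twistedCoeff {N : ℕ} {k : ℤ} (f : CuspForm (Gamma0GL N) k) (x : ℚ) (n : ℕ) :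
    ℂ :=
  cuspFourierCoeff f n * Complex.exp (2 * Real.pi * Complex.I * x * n)

/-- `L` is an entire continuation of the Dirichlet series `∑_{n ≥ 1} a(n) n^{-s}`: the series
converges absolutely in some right half-plane, `L` is entire, and `L` is the sum of the series
in the half-plane of absolute convergence. By the identity theorem there is at most one such
`L`. -/
structure IsEntireContinuation (a : ℕ → ℂ) (L : ℂ → ℂ) : Prop where
  abscissa_lt_top : LSeries.abscissaOfAbsConv a < ⊤
  differentiable : Differentiable ℂ L
  eq_LSeries : ∀ s : ℂ, LSeries.abscissaOfAbsConv a < (s.re : EReal) → L s = LSeries a s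

open Classical in
/-- The additively twisted `L`-function `L_x(s, f)`: the entire continuation of
`∑_{n ≥ 1} a_f(n) exp(2πixn) n^{-s}` (and `0` by convention if there were none). -/
noncomputable def twistedLFunction {N : ℕ} {k : ℤ} (f : CuspForm (Gamma0GL N) k) (x : ℚ) :
    ℂ → ℂ :=
  if h : ∃ L : ℂ → ℂ, IsEntireContinuation (twistedCoeff f x) L then h.choose else 0

/-- The number (in `ℕ ∪ {∞}`) of distinct zeros of `L_x(s, f)` of the form
`s = k/2 + it` with `0 ≤ t ≤ T`. -/
noncomputable def criticalZeroCount {N : ℕ} {k : ℤ} (f : CuspForm (Gamma0GL N) k) (x : ℚ)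
    (T : ℝ) : ℕ∞ :=
  {t : ℝ | 0 ≤ t ∧ t ≤ T ∧
    twistedLFunction f x ((k : ℂ) / 2 + (t : ℂ) * Complex.I) = 0}.encard

/-! This is the Hardy–Littlewood method. Assume `q > 0` and put F(w) = f((p + iw)/q) on Re w > 0.
Equivalence to the cusp ∞ together with p² ≡ 1 (mod q) forces N ∣ q, so a matrix (p, m; q, p) lies
in Γ₀(N); it carries (-p + iw)/q to (p + i/w)/q. Reality of the coefficients, up to a factor i,
relates f at τ and at -τ̄. Together they give F(1/w) = η(iw)^k · conj F(w̄) with η = ±1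
(`halfPlaneRestriction_inv`), so the Mellin transform of F has constant phase on Re s = k/2.

The Mellin transform along the ray arg w = φ is e^{-iφs} (2π/q)^{-s} Γ(s) L(s). With φ = π/2 - 1/T
the factor e^{φu} cancels the decay of Γ for T ≤ u ≤ 3T (`le_norm_mellin_rotate`, which rests on a
Stirling-type lower bound). A constant phase turns this into a continuous real function Z with |Z| ≫
T^{(k-1)/2} |L| there (`exists_real_function_bounds`). Since |F(w)| ≪ (Re w)^{-k/2} and cos φ ≍ 1/T,
Plancherel gives two mean squares: ∫ |L(k/2 + β + iu)|² du ≪ T/β over [T, 3T], and ∫ (∫_t^{t+h} Z)²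
dt ≪ T^k h over [T, 2T]. The second saves a factor h over what the size of Z alone suggests.

Let S ⊆ [T, 2T] be a set of t, of measure μ, for which (t, t + h) contains no zero. There |∫Z| =
∫|Z|, and Cauchy's theorem on a rectangle reaching into the region where the leading Dirichlet term
dominates gives ∫_t^{t+h} |L| ≫ h, up to two horizontal integrals that are small on average.
Integrating over S and using Cauchy–Schwarz gives hμ ≪ √(hTμ), so μ ≤ T/2 for a large fixed h
(`volume_zeroFree_le`). Hence the intervals of length h ending at zeros cover at least half of [T,
2T], which requires ≫ T zeros (`exists_lt_liminf_of_zeroFree`). -/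

/-! ### Lower bounds of Stirling type for the Gamma function -/

open Filter Topology in
-- Linear interpolation of b ↦ log|z + b| between 0 and 1, with an error that is summable over z = s
-- + j, uniformly in s. It comes from log(1 + y) ≤ y at b and log(1 + ε) ≥ ε - ε² at 1.
theorem log_norm_add_le {z : ℂ} (hre : 0 ≤ z.re) (him : 1 ≤ z.im) {b : ℝ} (hb0 : 0 ≤ b)
    (hb1 : b ≤ 1) :
    Real.log ‖z + b‖ ≤ (1 - b) * Real.log ‖z‖ + b * Real.log ‖z + 1‖ + 4 / (z.re ^ 2 + 1) := by
  set x := z.re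
  set u := z.im
  have hlog (w : ℂ) : Real.log ‖w‖ = Real.log (w.re ^ 2 + w.im ^ 2) / 2 := by
    rw [show w.re ^ 2 + w.im ^ 2 = ‖w‖ ^ 2 by rw [Complex.sq_norm, Complex.normSq_apply]; ring,
      Real.log_pow]
    push_cast; ring
  rw [hlog, hlog, hlog]
  simp only [Complex.add_re, Complex.add_im, Complex.ofReal_re, Complex.ofReal_im, Complex.one_re,
    Complex.one_im, add_zero]
  change Real.log ((x + b) ^ 2 + u ^ 2) / 2 ≤ (1 - b) * (Real.log (x ^ 2 + u ^ 2) / 2) +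
    b * (Real.log ((x + 1) ^ 2 + u ^ 2) / 2) + 4 / (x ^ 2 + 1)
  set A := x ^ 2 + u ^ 2 with hA
  have hA1 : x ^ 2 + 1 ≤ A := by nlinarith
  have hApos : 0 < A := by nlinarith [sq_nonneg x]
  set ε := (2 * x + 1) / A with hε
  have hε0 : 0 ≤ ε := by positivity
  have h1 : Real.log ((x + b) ^ 2 + u ^ 2) ≤ Real.log A + (2 * x * b + b ^ 2) / A := by
    have : (x + b) ^ 2 + u ^ 2 = A * (1 + (2 * x * b + b ^ 2) / A) := by
      field_simp; rw [hA]; ring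
    have hp : 0 < 1 + (2 * x * b + b ^ 2) / A := by positivity
    rw [this, Real.log_mul hApos.ne' hp.ne']
    linarith [Real.log_le_sub_one_of_pos hp]
  have h2 : Real.log A + ε - ε ^ 2 ≤ Real.log ((x + 1) ^ 2 + u ^ 2) := by
    have : (x + 1) ^ 2 + u ^ 2 = A * (1 + ε) := by
      rw [hε]; field_simp; rw [hA]; ring
    have hp : 0 < 1 + ε := by positivity
    rw [this, Real.log_mul hApos.ne' hp.ne']
    have := Real.one_sub_inv_le_log_of_pos hp
    have h3 : ε - ε ^ 2 ≤ 1 - (1 + ε)⁻¹ := by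
      have : 1 - (1 + ε)⁻¹ = ε / (1 + ε) := by field_simp; ring
      rw [this, le_div_iff₀ hp]
      nlinarith [pow_nonneg hε0 3]
    linarith
  have h4 : (2 * x * b + b ^ 2) / A ≤ b * ε := by
    rw [hε, mul_div_assoc', div_le_div_iff_of_pos_right hApos]
    nlinarith
  have h5 : b * ε ^ 2 ≤ 8 / (x ^ 2 + 1) := by
    have : ε ^ 2 ≤ 8 / (x ^ 2 + 1) := by
      rw [hε, div_pow, div_le_div_iff₀ (by positivity) (by positivity)]
      have : (2 * x + 1) ^ 2 ≤ 8 * (x ^ 2 + 1) := by nlinarith [sq_nonneg (x - 1)]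
      have h7 : (2 * x + 1) ^ 2 * (x ^ 2 + 1) ≤ 8 * (x ^ 2 + 1) * (x ^ 2 + 1) := by gcongr
      nlinarith
    calc b * ε ^ 2 ≤ 1 * ε ^ 2 := by gcongr
      _ ≤ _ := by linarith
  have h6 := mul_le_mul_of_nonneg_left h2 hb0
  have h8 : 4 / (x ^ 2 + 1) = (8 / (x ^ 2 + 1)) / 2 := by ring
  rw [h8]
  linarith

theorem summable_four_div_sq : Summable fun j : ℕ ↦ (4 : ℝ) / ((j : ℝ) ^ 2 + 1) := by
  have h := ((summable_nat_add_iff 1).2 (Real.summable_one_div_nat_pow.2 one_lt_two)).mul_left 8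
  refine h.of_nonneg_of_le (fun j ↦ by positivity) fun j ↦ ?_
  rw [mul_one_div, div_le_div_iff₀ (by positivity) (by positivity)]
  push_cast
  nlinarith [sq_nonneg ((j : ℝ) - 1)]

open Filter Topology in
/-- A uniform form of `|Γ(s + b) / Γ(s)| ≫ |s| ^ b`. -/
theorem norm_Gamma_add_ge : ∃ c : ℝ, 0 < c ∧ ∀ s : ℂ, 0 ≤ s.re → 1 ≤ s.im → ∀ b : ℝ, 0 ≤ b →
    b ≤ 1 → c * ‖s‖ ^ b * ‖Complex.Gamma s‖ ≤ ‖Complex.Gamma (s + b)‖ := by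
  set K : ℝ := ∑' j : ℕ, (4 : ℝ) / ((j : ℝ) ^ 2 + 1)
  refine ⟨Real.exp (-K), Real.exp_pos _, fun s hre him b hb0 hb1 ↦ ?_⟩
  have hne (j : ℕ) (t : ℝ) : 0 < ‖s + t + j‖ := by
    rw [norm_pos_iff]
    intro h
    have := congrArg Complex.im h
    simp at this
    linarith
  have hne0 (j : ℕ) : 0 < ‖s + j‖ := by simpa using hne j 0
  -- These products are the denominators in Euler's limit for Γ. Summing the interpolation
  -- inequality over j telescopes the main term to b·log(|s + n + 1| / |s|), and the errors add up
  -- to at most K.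
  have hprod (n : ℕ) : ∏ j ∈ Finset.range (n + 1), ‖s + b + j‖ ≤
      (∏ j ∈ Finset.range (n + 1), ‖s + j‖) * (‖s + (n + 1 : ℕ)‖ / ‖s‖) ^ b * Real.exp K := by
    have hs0 : 0 < ‖s‖ := by simpa using hne0 0
    have hq : 0 < ‖s + (n + 1 : ℕ)‖ / ‖s‖ := div_pos (hne0 _) hs0
    have hP : 0 < ∏ j ∈ Finset.range (n + 1), ‖s + j‖ := Finset.prod_pos fun j _ ↦ hne0 j
    rw [← Real.log_le_log_iff (Finset.prod_pos fun j _ ↦ hne j b) (by positivity),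
      Real.log_mul (by positivity) (Real.exp_pos _).ne', Real.log_mul hP.ne' (by positivity),
      Real.log_exp, Real.log_rpow hq, Real.log_div (hne0 _).ne' hs0.ne',
      Real.log_prod (fun j _ ↦ (hne j b).ne'), Real.log_prod (fun j _ ↦ (hne0 j).ne')]
    have htel := Finset.sum_range_sub (fun j : ℕ ↦ Real.log ‖s + j‖) (n + 1)
    have hK : ∑ j ∈ Finset.range (n + 1), (4 : ℝ) / ((j : ℝ) ^ 2 + 1) ≤ K :=
      summable_four_div_sq.sum_le_tsum _ fun j _ ↦ by positivity
    have hterm : ∀ j ∈ Finset.range (n + 1), Real.log ‖s + b + j‖ ≤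
        Real.log ‖s + j‖ + b * (Real.log ‖s + (j + 1 : ℕ)‖ - Real.log ‖s + j‖) +
          4 / ((j : ℝ) ^ 2 + 1) := fun j _ ↦ by
      have := log_norm_add_le (z := s + j) (by simp; positivity) (by simpa using him) hb0 hb1
      have h2 : 4 / ((s + j).re ^ 2 + 1) ≤ 4 / ((j : ℝ) ^ 2 + 1) := by
        have : (j : ℝ) ≤ (s + j).re := by simpa using hre
        gcongr
      rw [add_right_comm] at this
      push_cast
      rw [← add_assoc]
      linarith
    have hsum := Finset.sum_le_sum hterm
    rw [Finset.sum_add_distrib, Finset.sum_add_distrib, ← Finset.mul_sum, htel] at hsum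
    simp only [Nat.cast_zero, add_zero] at hsum
    linarith
  have hlim : Tendsto (fun n : ℕ ↦ Real.exp (-K) * (‖s‖ * (‖(n : ℂ)‖ / ‖s + (n + 1 : ℕ)‖)) ^ b *
      ‖Complex.GammaSeq s n‖) atTop (𝓝 (Real.exp (-K) * (‖s‖ * 1) ^ b * ‖Complex.Gamma s‖)) := by
    have h1 : Tendsto (fun n : ℕ ↦ ‖(n : ℂ)‖ / ‖s + (n + 1 : ℕ)‖) atTop (𝓝 1) := by
      have : Tendsto (fun n : ℕ ↦ (n : ℂ) / (n + (s + 1))) atTop (𝓝 1) :=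
        tendsto_natCast_div_add_atTop _
      have h2 := this.norm
      simp only [norm_div, norm_one] at h2
      refine h2.congr fun n ↦ ?_
      congr 2
      push_cast; ring
    exact (((h1.const_mul _).rpow_const (Or.inr hb0)).const_mul _).mul
      (Complex.GammaSeq_tendsto_Gamma s).norm
  rw [mul_one] at hlim
  refine le_of_tendsto_of_tendsto hlim (Complex.GammaSeq_tendsto_Gamma (s + b)).norm ?_
  filter_upwards [eventually_gt_atTop 0] with n hn
  have hs0 : 0 < ‖s‖ := by simpa using hne0 0
  have hn' : (0 : ℝ) < n := by exact_mod_cast hn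
  simp only [Complex.GammaSeq, norm_div, norm_mul, norm_prod]
  have hP : 0 < ∏ j ∈ Finset.range (n + 1), ‖s + j‖ := Finset.prod_pos fun j _ ↦ hne0 j
  rw [← Complex.ofReal_natCast, Complex.norm_cpow_eq_rpow_re_of_pos hn',
    Complex.norm_cpow_eq_rpow_re_of_pos hn', Complex.norm_real, Real.norm_of_nonneg hn'.le]
  simp only [Complex.add_re, Complex.ofReal_re, Real.rpow_add hn']
  rw [le_div_iff₀ (Finset.prod_pos fun j _ ↦ hne j b)]
  refine (mul_le_mul_of_nonneg_left (hprod n) (by positivity)).trans (le_of_eq ?_)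
  have hsn := hne0 (n + 1)
  rw [Real.mul_rpow hs0.le (by positivity), Real.div_rpow hn'.le hsn.le,
    Real.div_rpow hsn.le hs0.le, Real.exp_neg]
  have := Real.rpow_pos_of_pos hsn b
  have := Real.rpow_pos_of_pos hs0 b
  field_simp

/-- The reflection formula on Re s = 1/2 reads |Γ(1/2 + iu)|² = π / cosh(πu). -/
theorem norm_Gamma_half_ge (u : ℝ) :
    Real.exp (-(Real.pi * |u| / 2)) ≤ ‖Complex.Gamma (1 / 2 + u * Complex.I)‖ := by
  have h := Complex.Gamma_mul_Gamma_one_sub (1 / 2 + u * Complex.I)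
  have hc : (1 : ℂ) - (1 / 2 + u * Complex.I) =
      (starRingEnd ℂ) (1 / 2 + u * Complex.I) := by
    simp [Complex.ext_iff]; norm_num
  have hs : Complex.sin (Real.pi * (1 / 2 + u * Complex.I)) = (Real.cosh (Real.pi * u) : ℂ) := by
    rw [show (Real.pi : ℂ) * (1 / 2 + u * Complex.I) =
      (Real.pi * u : ℂ) * Complex.I + Real.pi / 2 by ring, Complex.sin_add_pi_div_two,
      Complex.cos_mul_I]
    push_cast; rfl
  rw [hc, Complex.Gamma_conj, hs] at h
  have h2 := congrArg norm h
  rw [norm_mul, RCLike.norm_conj, ← sq, norm_div, Complex.norm_real, Complex.norm_real,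
    Real.norm_of_nonneg Real.pi_pos.le, Real.norm_of_nonneg (Real.cosh_pos _).le] at h2
  rw [← pow_le_pow_iff_left₀ (Real.exp_pos _).le (norm_nonneg _) two_ne_zero, h2,
    le_div_iff₀ (Real.cosh_pos _), ← Real.exp_nat_mul]
  have h3 : Real.cosh (Real.pi * u) ≤ Real.exp (Real.pi * |u|) := by
    rw [← Real.cosh_abs, abs_mul, abs_of_pos Real.pi_pos, Real.cosh_eq]
    have : Real.exp (-(Real.pi * |u|)) ≤ Real.exp (Real.pi * |u|) := by
      apply Real.exp_le_exp.2
      have : 0 ≤ Real.pi * |u| := by positivity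
      linarith
    linarith
  calc _ ≤ Real.exp (((2 : ℕ) : ℝ) * -(Real.pi * |u| / 2)) * Real.exp (Real.pi * |u|) := by gcongr
    _ = 1 := by rw [← Real.exp_add]; push_cast; ring_nf; exact Real.exp_zero
    _ ≤ Real.pi := by linarith [Real.pi_gt_three]

/-- A lower bound of Stirling type for the Gamma function in vertical strips. -/
theorem exists_le_norm_Gamma (σ₀ σ₁ : ℝ) : ∃ c : ℝ, 0 < c ∧ ∀ σ u : ℝ, σ₀ ≤ σ → σ ≤ σ₁ → 1 ≤ u →
    c * u ^ (σ - 1 / 2) * Real.exp (-(Real.pi * u / 2)) ≤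
      ‖Complex.Gamma (σ + u * Complex.I)‖ := by
  -- The strip 1/2 ≤ σ ≤ 3/2 is reached from the line σ = 1/2 by `norm_Gamma_add_ge` with b = σ -
  -- 1/2; Γ(s + 1) = sΓ(s) then widens it by one on each side per induction step.
  have key (n : ℕ) : ∃ c : ℝ, 0 < c ∧ ∀ σ u : ℝ, 1 / 2 - n ≤ σ → σ ≤ 3 / 2 + n → 1 ≤ u →
      c * u ^ (σ - 1 / 2) * Real.exp (-(Real.pi * u / 2)) ≤
        ‖Complex.Gamma (σ + u * Complex.I)‖ := by
    have him (σ u : ℝ) (hu : 1 ≤ u) : u ≤ ‖(σ : ℂ) + u * Complex.I‖ := by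
      have := Complex.abs_im_le_norm ((σ : ℂ) + u * Complex.I)
      simp only [Complex.add_im, Complex.ofReal_im, Complex.mul_im, Complex.ofReal_re,
        Complex.I_im, Complex.I_re] at this
      refine le_trans ?_ this
      rw [abs_of_nonneg] <;> linarith
    induction n with
    | zero =>
      obtain ⟨c, hc, h⟩ := norm_Gamma_add_ge
      refine ⟨c, hc, fun σ u h0 h1 hu ↦ ?_⟩
      have := h (1 / 2 + u * Complex.I) (by norm_num) (by simpa using hu) (σ - 1 / 2)
        (by norm_num at h0; linarith) (by norm_num at h1; linarith)
      rw [show (1 / 2 + u * Complex.I : ℂ) + (σ - 1 / 2 : ℝ) = σ + u * Complex.I by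
        push_cast; ring] at this
      refine le_trans ?_ this
      have h2 := norm_Gamma_half_ge u
      rw [abs_of_nonneg (by linarith)] at h2
      have h3 := him (1 / 2) u hu
      push_cast at h3
      have h4 : 0 ≤ σ - 1 / 2 := by norm_num at h0; linarith
      gcongr
    | succ n ih =>
      obtain ⟨c, hc, h⟩ := ih
      refine ⟨min c (c / (n + 2)), lt_min hc (by positivity), fun σ u h0 h1 hu ↦ ?_⟩
      have hu0 : 0 < u := by linarith
      push_cast at h0 h1
      have hsne (σ : ℝ) : (σ : ℂ) + u * Complex.I ≠ 0 := fun h ↦ by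
        have := congrArg Complex.im h
        simp at this
        linarith
      rcases lt_or_ge (3 / 2 + (n : ℝ)) σ with h2 | h2
      · have h3 := h (σ - 1) u (by have : (0:ℝ) ≤ n := n.cast_nonneg; linarith) (by linarith) hu
        have h4 := Complex.Gamma_add_one _ (hsne (σ - 1))
        rw [show ((σ - 1 : ℝ) : ℂ) + u * Complex.I + 1 = σ + u * Complex.I by
          push_cast; ring] at h4
        rw [h4, norm_mul]
        calc _ ≤ c * u ^ (σ - 1 / 2) * Real.exp (-(Real.pi * u / 2)) := by
              gcongr; exact min_le_left _ _
          _ = u * (c * u ^ (σ - 1 - 1 / 2) * Real.exp (-(Real.pi * u / 2))) := by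
              rw [show σ - 1 / 2 = (σ - 1 - 1 / 2) + 1 by ring, Real.rpow_add_one hu0.ne']; ring
          _ ≤ _ := by gcongr; exact him _ _ hu
      rcases lt_or_ge σ (1 / 2 - (n : ℝ)) with h5 | h5
      · have h3 := h (σ + 1) u (by linarith) (by have : (0:ℝ) ≤ n := n.cast_nonneg; linarith) hu
        have h4 := Complex.Gamma_add_one _ (hsne σ)
        rw [show (σ : ℂ) + u * Complex.I + 1 = (σ + 1 : ℝ) + u * Complex.I by
          push_cast; ring] at h4
        rw [h4, norm_mul] at h3
        have h6 : ‖(σ : ℂ) + u * Complex.I‖ ≤ (n + 2) * u := by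
          calc _ ≤ |σ| + u := by
                refine (norm_add_le _ _).trans ?_
                simp [abs_of_pos hu0]
            _ ≤ (n + 1) + u := by
                gcongr
                rw [abs_le]
                constructor <;> [linarith; (have : (0:ℝ) ≤ n := n.cast_nonneg; linarith)]
            _ ≤ _ := by have : (0:ℝ) ≤ n := n.cast_nonneg; nlinarith
        have h7 := h3.trans (mul_le_mul_of_nonneg_right h6 (norm_nonneg _))
        rw [show σ + 1 - 1 / 2 = (σ - 1 / 2) + 1 by ring, Real.rpow_add_one hu0.ne'] at h7
        calc _ ≤ c / (n + 2) * u ^ (σ - 1 / 2) * Real.exp (-(Real.pi * u / 2)) := by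
              gcongr; exact min_le_right _ _
          _ = (c * (u ^ (σ - 1 / 2) * u) * Real.exp (-(Real.pi * u / 2))) / ((n + 2) * u) := by
              field_simp
          _ ≤ _ := by rw [div_le_iff₀ (by positivity)]; linarith
      · calc _ ≤ c * u ^ (σ - 1 / 2) * Real.exp (-(Real.pi * u / 2)) := by
              gcongr; exact min_le_left _ _
          _ ≤ _ := h σ u h5 h2 hu
  obtain ⟨n, hn⟩ := exists_nat_ge (max (1 / 2 - σ₀) (σ₁ - 3 / 2))
  obtain ⟨c, hc, h⟩ := key n
  exact ⟨c, hc, fun σ u h0 h1 hu ↦ h σ u (by linarith [le_max_left (1 / 2 - σ₀) (σ₁ - 3 / 2)])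
    (by linarith [le_max_right (1 / 2 - σ₀) (σ₁ - 3 / 2)]) hu⟩

/-! ### Plancherel's theorem for the integral Fourier transform on L¹ ∩ L² -/

section Plancherel

open MeasureTheory FourierTransform SchwartzMap

theorem continuous_fourier_of_integrable {g : ℝ → ℂ} (h1 : Integrable g) : Continuous (𝓕 g) :=
  VectorFourier.fourierIntegral_continuous Real.continuous_fourierChar
    (by fun_prop) h1

/-- Both transforms can be moved onto a test function: the L² one through tempered distributions,
the integral one by Fubini. They therefore have the same pairing with every smooth compactly
supported function. -/
theorem ae_eq_fourier_toLp {g : ℝ → ℂ} (h1 : Integrable g) (h2 : MemLp g 2) :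
    (𝓕 (h2.toLp g) : Lp ℂ 2 (volume : Measure ℝ)) =ᵐ[volume] 𝓕 g := by
  refine ae_eq_of_integral_contDiff_smul_eq
    ((Lp.memLp _).locallyIntegrable one_le_two)
    (continuous_fourier_of_integrable h1).locallyIntegrable fun φ hφ hφc ↦ ?_
  have hc1 : HasCompactSupport (fun x ↦ (φ x : ℂ)) := hφc.comp_left Complex.ofReal_zero
  have hc2 : ContDiff ℝ (⊤ : ℕ∞) (fun x ↦ (φ x : ℂ)) := Complex.ofRealCLM.contDiff.comp hφ
  set Φ : 𝓢(ℝ, ℂ) := hc1.toSchwartzMap hc2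
  have hΦ (x : ℝ) : Φ x = φ x := rfl
  have e1 := congrArg (fun T : TemperedDistribution ℝ ℂ ↦ T Φ)
    (Lp.fourier_toTemperedDistribution_eq (h2.toLp g))
  simp only [TemperedDistribution.fourier_apply, Lp.toTemperedDistribution_apply] at e1
  have e2 : ∫ x, (𝓕 Φ) x • (h2.toLp g) x = ∫ x, (𝓕 Φ) x • g x :=
    integral_congr_ae (by filter_upwards [h2.coeFn_toLp] with x hx; rw [hx])
  have e3 : ∫ x, (𝓕 (Φ : ℝ → ℂ)) x • g x = ∫ x, Φ x • (𝓕 g) x := by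
    simpa using! (VectorFourier.integral_fourierIntegral_smul_eq_flip (L := innerₗ ℝ)
      Real.continuous_fourierChar continuous_inner Φ.integrable h1)
  rw [e2, fourier_coe, e3] at e1
  simpa only [hΦ, Complex.coe_smul] using! e1.symm

/-- Plancherel's theorem for functions in `L¹ ∩ L²`. -/
theorem eLpNorm_fourier_eq {g : ℝ → ℂ} (h1 : Integrable g) (h2 : MemLp g 2) :
    eLpNorm (𝓕 g) 2 = eLpNorm g 2 := by
  rw [← eLpNorm_congr_ae (ae_eq_fourier_toLp h1 h2), ← eLpNorm_congr_ae h2.coeFn_toLp,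
    ← Lp.enorm_def, ← Lp.enorm_def, enorm_eq_iff_norm_eq, Lp.norm_fourier_eq]

theorem lintegral_enorm_fourier_sq_eq {g : ℝ → ℂ} (h1 : Integrable g) (h2 : MemLp g 2) :
    ∫⁻ ξ, ‖𝓕 g ξ‖ₑ ^ 2 = ∫⁻ x, ‖g x‖ₑ ^ 2 := by
  have h := eLpNorm_fourier_eq h1 h2
  rw [eLpNorm_eq_lintegral_rpow_enorm_toReal two_ne_zero ENNReal.ofNat_ne_top,
    eLpNorm_eq_lintegral_rpow_enorm_toReal two_ne_zero ENNReal.ofNat_ne_top] at h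
  simpa using ENNReal.rpow_left_injective (by simp) h

theorem memLp_fourier {g : ℝ → ℂ} (h1 : Integrable g) (h2 : MemLp g 2) : MemLp (𝓕 g) 2 :=
  ⟨(continuous_fourier_of_integrable h1).aestronglyMeasurable,
    (eLpNorm_fourier_eq h1 h2).trans_lt h2.2⟩

theorem integral_norm_fourier_sq_eq {g : ℝ → ℂ} (h1 : Integrable g) (h2 : MemLp g 2) :
    ∫ ξ, ‖𝓕 g ξ‖ ^ 2 = ∫ x, ‖g x‖ ^ 2 := by
  have h (f : ℝ → ℂ) (hf : AEStronglyMeasurable f) :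
      ∫ x, ‖f x‖ ^ 2 = (∫⁻ x, ‖f x‖ₑ ^ 2).toReal := by
    rw [integral_eq_lintegral_of_nonneg_ae (f := fun x ↦ ‖f x‖ ^ 2)
      (.of_forall fun x ↦ sq_nonneg _) (hf.norm.pow 2)]
    congr 2 with x
    rw [ENNReal.ofReal_pow (norm_nonneg _), ofReal_norm]
  rw [h _ (continuous_fourier_of_integrable h1).aestronglyMeasurable, h _ h2.1,
    lintegral_enorm_fourier_sq_eq h1 h2]

end Plancherel

/-! ### Integrals of exp(-a|x|) -/

section ExpAbs

open MeasureTheory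

theorem integrable_exp_neg_mul_abs {a : ℝ} (ha : 0 < a) :
    Integrable fun x : ℝ ↦ Real.exp (-(a * |x|)) := by
  rw [← integrableOn_univ, ← Set.Iic_union_Ioi (a := (0 : ℝ))]
  refine IntegrableOn.union ?_ ?_
  · refine (integrableOn_exp_mul_Iic ha 0).congr_fun (fun x hx ↦ ?_) measurableSet_Iic
    simp only [abs_of_nonpos (Set.mem_Iic.1 hx)]
    ring_nf
  · refine (integrableOn_exp_mul_Ioi (neg_lt_zero.2 ha) 0).congr_fun (fun x hx ↦ ?_)
      measurableSet_Ioi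
    simp only [abs_of_pos (Set.mem_Ioi.1 hx)]
    ring_nf

theorem integral_exp_neg_mul_abs {a : ℝ} (ha : 0 < a) :
    ∫ x : ℝ, Real.exp (-(a * |x|)) = 2 / a := by
  have h := integral_comp_abs (f := fun x ↦ Real.exp (-(a * x)))
  have h2 := integral_exp_mul_Ioi (neg_lt_zero.2 ha) 0
  simp only [neg_mul] at h2
  rw [h, h2]
  simp
  field_simp

end ExpAbs

/-! ### Mean squares of Mellin transforms along rotated rays -/

section HalfPlane

open MeasureTheory FourierTransform Complex

/-- A continuous function on the right half-plane which satisfies the bounds of a cusp form of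
weight `k` (in the variable `w` for which `z = x + iw`), and which has the symmetry of a cusp form
under `w ↦ 1 / w`, as far as absolute values are concerned. -/
structure CuspidalOnHalfPlane (k : ℝ) (F : ℂ → ℂ) : Prop where
  continuousOn : ContinuousOn F {w | 0 < w.re}
  bound : ∀ M : ℝ, 0 ≤ M → ∃ C : ℝ, ∀ w : ℂ, 0 < w.re → ‖F w‖ ≤ C * w.re ^ (-k / 2 - M)
  norm_inv : ∀ w : ℂ, 0 < w.re → ‖F w⁻¹‖ = ‖w‖ ^ k * ‖F (starRingEnd ℂ w)‖

/-- The function whose Fourier transform is the Mellin transform of `t ↦ F (e^{iφ} t)` on the line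
`Re s = σ`. -/
noncomputable def mellinKernel (F : ℂ → ℂ) (φ σ : ℝ) (x : ℝ) : ℂ :=
  Real.exp (-σ * x) • F (exp (φ * I) * (Real.exp (-x) : ℝ))

theorem mellin_rotate_eq_fourier (F : ℂ → ℂ) (φ σ u : ℝ) :
    mellin (fun t : ℝ ↦ F (exp (φ * I) * t)) (σ + u * I) =
      𝓕 (mellinKernel F φ σ) (u / (2 * Real.pi)) := by
  rw [mellin_eq_fourier]
  have h1 : ((σ : ℂ) + u * I).re = σ := by simp
  have h2 : ((σ : ℂ) + u * I).im = u := by simp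
  rw [h1, h2]
  rfl

namespace CuspidalOnHalfPlane

variable {k : ℝ} {F : ℂ → ℂ} (hF : CuspidalOnHalfPlane k F)
include hF

/-- For x ≥ 0 this is `bound` on the ray. The weight e^{kx/2} makes the left side even in x, by
`norm_inv` at w = e^{-iφ}e^{-x}, so the decay at infinity also holds towards 0. -/
theorem norm_rotate_le {M : ℝ} (hM : 0 ≤ M) : ∃ C : ℝ, 0 ≤ C ∧ ∀ φ : ℝ, 0 < Real.cos φ → ∀ x : ℝ,
    Real.exp (k / 2 * x) * ‖F (exp (φ * I) * (Real.exp x : ℝ))‖ ≤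
      C * Real.cos φ ^ (-k / 2) * (Real.exp |x| * Real.cos φ) ^ (-M) := by
  obtain ⟨C, hC⟩ := hF.bound M hM
  refine ⟨max C 0, le_max_right _ _, fun φ hφ x ↦ ?_⟩
  have hre (x : ℝ) : (exp (φ * I) * (Real.exp x : ℝ)).re = Real.cos φ * Real.exp x := by
    rw [re_mul_ofReal, exp_ofReal_mul_I_re]
  have key (x : ℝ) (hx : 0 ≤ x) :
      Real.exp (k / 2 * x) * ‖F (exp (φ * I) * (Real.exp x : ℝ))‖ ≤
      max C 0 * Real.cos φ ^ (-k / 2) * (Real.exp x * Real.cos φ) ^ (-M) := by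
    have h := hC (exp (φ * I) * (Real.exp x : ℝ)) (by rw [hre]; positivity)
    rw [hre] at h
    calc _ ≤ Real.exp (k / 2 * x) *
          (max C 0 * (Real.cos φ * Real.exp x) ^ (-k / 2 - M)) := by
          gcongr
          refine h.trans ?_
          gcongr
          exact le_max_left _ _
      _ = _ := by
        rw [sub_eq_add_neg, Real.rpow_add (by positivity), Real.mul_rpow hφ.le (Real.exp_pos _).le,
          mul_comm (Real.exp x), ← Real.exp_mul]
        have : Real.exp (k / 2 * x) * Real.exp (x * (-k / 2)) = 1 := by
          rw [← Real.exp_add]; ring_nf; exact Real.exp_zero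
        linear_combination (max C 0 * Real.cos φ ^ (-k / 2) *
          (Real.cos φ * Real.exp x) ^ (-M)) * this
  rcases le_total 0 x with hx | hx
  · rw [abs_of_nonneg hx]; exact key x hx
  · have h := key (-x) (by linarith)
    rw [abs_of_nonpos hx]
    refine le_trans (le_of_eq ?_) h
    have h1 := hF.norm_inv (exp ((-φ : ℝ) * I) * (Real.exp (-x) : ℝ)) (by
      rw [re_mul_ofReal, exp_ofReal_mul_I_re, Real.cos_neg]; positivity)
    have h2 : (exp ((-φ : ℝ) * I) * (Real.exp (-x) : ℝ))⁻¹ = exp (φ * I) * (Real.exp x : ℝ) := by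
      rw [mul_inv, ← exp_neg, ofReal_exp, ofReal_exp, ← exp_neg]
      congr 2 <;> push_cast <;> ring
    have h3 : (starRingEnd ℂ) (exp ((-φ : ℝ) * I) * (Real.exp (-x) : ℝ)) =
        exp (φ * I) * (Real.exp (-x) : ℝ) := by
      rw [map_mul, conj_ofReal, ← exp_conj, map_mul, conj_ofReal, conj_I]
      congr 2
      push_cast; ring
    rw [h2, h3, norm_mul, norm_exp_ofReal_mul_I, one_mul, norm_real,
      Real.norm_of_nonneg (Real.exp_pos _).le, ← Real.exp_mul] at h1
    rw [h1, ← mul_assoc, ← Real.exp_add]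
    congr 2
    ring

theorem continuous_mellinKernel {φ : ℝ} (hφ : 0 < Real.cos φ) (σ : ℝ) :
    Continuous (mellinKernel F φ σ) := by
  unfold mellinKernel
  refine Continuous.smul (f := fun x : ℝ ↦ Real.exp (-σ * x)) (by fun_prop)
    (hF.continuousOn.comp_continuous
      (f := fun x : ℝ ↦ exp (φ * I) * (Real.exp (-x) : ℝ)) (by fun_prop) fun x ↦ ?_)
  change 0 < (exp (φ * I) * (Real.exp (-x) : ℝ)).re
  rw [re_mul_ofReal, exp_ofReal_mul_I_re]
  positivity

/-- Uniform bound for the kernel on the line `Re s = k / 2 + β`. -/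
theorem norm_mellinKernel_le {M : ℝ} (hM : 0 ≤ M) : ∃ C : ℝ, 0 ≤ C ∧ ∀ φ : ℝ, 0 < Real.cos φ →
    ∀ β x : ℝ, 0 ≤ β → ‖mellinKernel F φ (k / 2 + β) x‖ ≤
      C * Real.cos φ ^ (-k / 2) * (Real.exp |x| * Real.cos φ) ^ (-M) * Real.exp (β * |x|) := by
  obtain ⟨C, hC0, hC⟩ := hF.norm_rotate_le hM
  refine ⟨C, hC0, fun φ hφ β x hβ ↦ ?_⟩
  have h := hC φ hφ (-x)
  rw [abs_neg] at h
  rw [mellinKernel, norm_smul, Real.norm_of_nonneg (Real.exp_pos _).le,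
    show -(k / 2 + β) * x = k / 2 * (-x) + β * (-x) by ring, Real.exp_add, mul_right_comm]
  gcongr
  exact neg_le_abs x

theorem exists_norm_mellinKernel_le_exp {φ : ℝ} (hφ : 0 < Real.cos φ) (σ : ℝ) :
    ∃ C : ℝ, 0 ≤ C ∧ ∀ x, ‖mellinKernel F φ σ x‖ ≤ C * Real.exp (-(1 * |x|)) := by
  -- One power of e^{-|x|} more than is needed to absorb the shift from the line k/2. The uniform
  -- bound is stated for β ≥ 0 only, so σ < k/2 goes through β = 0.
  obtain ⟨C, hC0, hC⟩ := hF.norm_mellinKernel_le (M := |σ - k / 2| + 1) (by positivity)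
  refine ⟨C * Real.cos φ ^ (-k / 2) * Real.cos φ ^ (-(|σ - k / 2| + 1)), by positivity,
    fun x ↦ ?_⟩
  rcases le_total 0 (σ - k / 2) with h | h
  · have h1 := hC φ hφ (σ - k / 2) x h
    rw [add_sub_cancel] at h1
    refine h1.trans (le_of_eq ?_)
    rw [abs_of_nonneg h, mul_comm (Real.exp |x|), Real.mul_rpow hφ.le (Real.exp_pos _).le,
      ← Real.exp_mul, ← mul_assoc, mul_assoc (_ * _), ← Real.exp_add]
    congr 2
    ring
  · have h1 := hC φ hφ 0 x le_rfl
    have h2 : mellinKernel F φ σ x =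
        Real.exp (-(σ - k / 2) * x) • mellinKernel F φ (k / 2 + 0) x := by
      rw [mellinKernel, mellinKernel, ← mul_smul, ← Real.exp_add]
      congr 2; ring
    rw [h2, norm_smul, Real.norm_of_nonneg (Real.exp_pos _).le]
    calc _ ≤ Real.exp (|σ - k / 2| * |x|) * (C * Real.cos φ ^ (-k / 2) *
          (Real.exp |x| * Real.cos φ) ^ (-(|σ - k / 2| + 1)) * Real.exp (0 * |x|)) := by
          refine mul_le_mul (Real.exp_le_exp.2 ?_) h1 (norm_nonneg _) (Real.exp_pos _).le
          rw [abs_of_nonpos h]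
          exact mul_le_mul_of_nonneg_left (le_abs_self x) (by linarith)
      _ = _ := by
        rw [mul_comm (Real.exp |x|), Real.mul_rpow hφ.le (Real.exp_pos _).le,
          ← Real.exp_mul, zero_mul, Real.exp_zero, mul_one]
        have : Real.exp (|σ - k / 2| * |x|) * Real.exp (|x| * -(|σ - k / 2| + 1)) =
            Real.exp (-(1 * |x|)) := by
          rw [← Real.exp_add]; congr 1; ring
        rw [← this]; ring

theorem integrable_mellinKernel {φ : ℝ} (hφ : 0 < Real.cos φ) (σ : ℝ) :
    Integrable (mellinKernel F φ σ) := by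
  obtain ⟨C, hC0, hC⟩ := hF.exists_norm_mellinKernel_le_exp hφ σ
  exact ((integrable_exp_neg_mul_abs one_pos).const_mul C).mono'
    (hF.continuous_mellinKernel hφ σ).aestronglyMeasurable (.of_forall hC)

theorem memLp_mellinKernel {φ : ℝ} (hφ : 0 < Real.cos φ) (σ : ℝ) :
    MemLp (mellinKernel F φ σ) 2 := by
  obtain ⟨C, hC0, hC⟩ := hF.exists_norm_mellinKernel_le_exp hφ σ
  rw [memLp_two_iff_integrable_sq_norm (hF.continuous_mellinKernel hφ σ).aestronglyMeasurable]
  refine ((integrable_exp_neg_mul_abs two_pos).const_mul (C ^ 2)).mono'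
    ((hF.continuous_mellinKernel hφ σ).norm.pow 2).aestronglyMeasurable (.of_forall fun x ↦ ?_)
  rw [Real.norm_of_nonneg (by positivity)]
  calc _ ≤ (C * Real.exp (-(1 * |x|))) ^ 2 := by gcongr; exact hC x
    _ = _ := by rw [mul_pow, ← Real.exp_nat_mul]; push_cast; ring_nf

open Filter Topology Asymptotics in
theorem differentiable_mellin {φ : ℝ} (hφ : 0 < Real.cos φ) :
    Differentiable ℂ (mellin fun t : ℝ ↦ F (exp (φ * I) * t)) := by
  intro s
  have hre (t : ℝ) : (exp (φ * I) * (t : ℝ)).re = Real.cos φ * t := by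
    rw [re_mul_ofReal, exp_ofReal_mul_I_re]
  have hloc : LocallyIntegrableOn (fun t : ℝ ↦ F (exp (φ * I) * t)) (Set.Ioi 0) := by
    refine ContinuousOn.locallyIntegrableOn ?_ measurableSet_Ioi
    refine hF.continuousOn.comp (by fun_prop) fun t ht ↦ ?_
    change 0 < (exp (φ * I) * (t : ℝ)).re
    rw [hre]
    exact mul_pos hφ ht
  have hb (σ : ℝ) : ∃ C : ℝ, ∀ t : ℝ, 0 < t → ‖F (exp (φ * I) * t)‖ ≤ C * t ^ (-σ) := by
    obtain ⟨C, hC0, hC⟩ := hF.exists_norm_mellinKernel_le_exp hφ σ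
    refine ⟨C, fun t ht ↦ ?_⟩
    have h := (hC (-Real.log t)).trans (mul_le_of_le_one_right hC0 (Real.exp_le_one_iff.2 (by
      have := abs_nonneg (-Real.log t); linarith)))
    rw [mellinKernel, norm_smul, Real.norm_of_nonneg (Real.exp_pos _).le, neg_neg, Real.exp_log ht,
      neg_mul_neg, mul_comm σ, ← Real.rpow_def_of_pos ht] at h
    rw [Real.rpow_neg ht.le, ← div_eq_mul_inv, le_div_iff₀ (by positivity)]
    linarith
  refine mellin_differentiableAt_of_isBigO_rpow (a := s.re + 1) (b := s.re - 1) hloc ?_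
    (by linarith) ?_ (by linarith)
  · obtain ⟨C, hC⟩ := hb (s.re + 1)
    refine IsBigO.of_bound C ?_
    filter_upwards [eventually_gt_atTop 0] with t ht
    rw [Real.norm_of_nonneg (by positivity)]
    exact hC t ht
  · obtain ⟨C, hC⟩ := hb (s.re - 1)
    refine IsBigO.of_bound C ?_
    filter_upwards [self_mem_nhdsWithin] with t ht
    have ht : 0 < t := ht
    rw [Real.norm_of_nonneg (by positivity)]
    exact hC t ht

theorem integrable_norm_mellin_sq {φ : ℝ} (hφ : 0 < Real.cos φ) (σ : ℝ) :
    Integrable fun u : ℝ ↦ ‖mellin (fun t : ℝ ↦ F (exp (φ * I) * t)) (σ + u * I)‖ ^ 2 := by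
  simp_rw [mellin_rotate_eq_fourier]
  have h := (memLp_fourier (hF.integrable_mellinKernel hφ σ)
    (hF.memLp_mellinKernel hφ σ)).integrable_norm_pow two_ne_zero
  exact h.comp_div (by positivity)

/-- Mean square of the rotated Mellin transform on the line `Re s = k / 2 + β`. -/
theorem integral_norm_mellin_sq_le (B : ℝ) : ∃ C : ℝ, 0 ≤ C ∧ ∀ φ : ℝ, 0 < Real.cos φ →
    ∀ β : ℝ, 0 < β → β ≤ B →
    ∫ u : ℝ, ‖mellin (fun t : ℝ ↦ F (exp (φ * I) * t)) ((k / 2 + β : ℝ) + u * I)‖ ^ 2 ≤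
      C * Real.cos φ ^ (-k - 2 * β) / β := by
  rcases lt_or_ge B 0 with hB | hB
  · exact ⟨0, le_rfl, fun φ _ β h1 h2 ↦ by linarith⟩
  obtain ⟨C₀, hC₀, h₀⟩ := hF.norm_mellinKernel_le le_rfl
  -- M = 0 serves for small |x|. For large |x| the choice M = 2B beats the growth e^{β|x|} and
  -- leaves decay at rate at least β, since β ≤ B.
  obtain ⟨C₁, hC₁, h₁⟩ := hF.norm_mellinKernel_le (M := 2 * B) (by linarith)
  set C := max C₀ C₁
  refine ⟨2 * Real.pi * (C ^ 2 * 2), by positivity, fun φ hφ β hβ hβB ↦ ?_⟩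
  simp_rw [mellin_rotate_eq_fourier]
  rw [Measure.integral_comp_div (fun ξ ↦ ‖𝓕 (mellinKernel F φ (k / 2 + β)) ξ‖ ^ 2),
    integral_norm_fourier_sq_eq (hF.integrable_mellinKernel hφ _) (hF.memLp_mellinKernel hφ _),
    abs_of_pos Real.two_pi_pos, smul_eq_mul, mul_assoc (2 * Real.pi), mul_div_assoc]
  gcongr
  set c := Real.cos φ
  have hc1 : c ≤ 1 := Real.cos_le_one φ
  -- The two bounds cross where e^{|x|} cos φ = 1, that is at |x| = X. The kernel is thus dominated
  -- by peaks at ±X of height cos(φ)^{-k/2 - β}, falling off like e^{-β||x| - X|}; integrating their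
  -- squares produces the factor 1/β.
  set X := -Real.log c
  have hX : 0 ≤ X := by
    have := Real.log_nonpos hφ.le hc1
    simp only [X]; linarith
  have hcX : c = Real.exp (-X) := by simp only [X, neg_neg]; rw [Real.exp_log hφ]
  have hexp : ∀ p : ℝ, c ^ p = Real.exp (-X * p) := fun p ↦ by
    rw [hcX, ← Real.exp_mul]
  have hpt (x : ℝ) : ‖mellinKernel F φ (k / 2 + β) x‖ ^ 2 ≤ C ^ 2 * c ^ (-k - 2 * β) *
      (Real.exp (-(2 * β * |x - X|)) + Real.exp (-(2 * β * |x - (-X)|))) := by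
    have hmax : Real.exp (-(2 * β * |(|x| - X)|)) ≤
        Real.exp (-(2 * β * |x - X|)) + Real.exp (-(2 * β * |x - (-X)|)) := by
      rcases le_total 0 x with hx | hx
      · rw [abs_of_nonneg hx]
        linarith [Real.exp_pos (-(2 * β * |x - (-X)|))]
      · rw [abs_of_nonpos hx, show -x - X = -(x - -X) by ring, abs_neg]
        linarith [Real.exp_pos (-(2 * β * |x - X|))]
    have hmain : ‖mellinKernel F φ (k / 2 + β) x‖ ≤ C * Real.exp (X * (k / 2 + β)) *
        Real.exp (-(β * |(|x| - X)|)) := by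
      rcases le_total |x| X with hx | hx
      · refine (h₀ φ hφ β x hβ.le).trans ?_
        rw [neg_zero, Real.rpow_zero, mul_one, hexp, abs_of_nonpos (sub_nonpos.2 hx)]
        rw [mul_assoc, mul_assoc, ← Real.exp_add, ← Real.exp_add]
        refine mul_le_mul (le_max_left _ _) (Real.exp_le_exp.2 (le_of_eq ?_)) (by positivity)
          (by positivity)
        ring
      · refine (h₁ φ hφ β x hβ.le).trans ?_
        rw [abs_of_nonneg (sub_nonneg.2 hx), hexp]
        rw [show Real.cos φ = Real.exp (-X) from hcX, ← Real.exp_add, ← Real.exp_mul, mul_assoc, mul_assoc, mul_assoc, ← Real.exp_add,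
          ← Real.exp_add, ← Real.exp_add]
        refine mul_le_mul (le_max_right _ _) (Real.exp_le_exp.2 ?_) (by positivity)
          (by positivity)
        nlinarith [mul_nonneg (sub_nonneg.2 hβB) (sub_nonneg.2 hx)]
    calc _ ≤ (C * Real.exp (X * (k / 2 + β)) * Real.exp (-(β * |(|x| - X)|))) ^ 2 := by gcongr
      _ = C ^ 2 * c ^ (-k - 2 * β) * Real.exp (-(2 * β * |(|x| - X)|)) := by
        rw [mul_pow, mul_pow, ← Real.exp_nat_mul, ← Real.exp_nat_mul, hexp]
        push_cast
        ring_nf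
      _ ≤ _ := by gcongr
  have hint := integrable_exp_neg_mul_abs (a := 2 * β) (by positivity)
  calc _ ≤ ∫ x, C ^ 2 * c ^ (-k - 2 * β) *
      (Real.exp (-(2 * β * |x - X|)) + Real.exp (-(2 * β * |x - (-X)|))) :=
        integral_mono ((hF.memLp_mellinKernel hφ _).integrable_norm_pow two_ne_zero)
          (((hint.comp_sub_right X).add (hint.comp_sub_right (-X))).const_mul _) hpt
    _ = _ := by
      rw [integral_const_mul, integral_add (hint.comp_sub_right X) (hint.comp_sub_right (-X)),
        integral_sub_right_eq_self (fun x ↦ Real.exp (-(2 * β * |x|))) X,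
        integral_sub_right_eq_self (fun x ↦ Real.exp (-(2 * β * |x|))) (-X),
        integral_exp_neg_mul_abs (by positivity)]
      field_simp
      ring

end CuspidalOnHalfPlane

/-- The function with Fourier transform the indicator function of `[-h, 0]`, up to scaling. -/
noncomputable def windowKernel (h x : ℝ) : ℂ := ∫ v in (0 : ℝ)..h, exp (-(v * x : ℝ) * I)

theorem continuous_windowKernel (h : ℝ) : Continuous (windowKernel h) :=
  intervalIntegral.continuous_parametric_intervalIntegral_of_continuous'
    (f := fun x v : ℝ ↦ exp (-(v * x : ℝ) * I)) (by fun_prop) 0 h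

/-- Combines the trivial bound h with the bound 2/|x| from integrating the exponential. The majorant
has integral of order h instead of h², which is the saving behind the zero count. -/
theorem norm_windowKernel_sq_le {h : ℝ} (hh : 0 < h) (x : ℝ) :
    ‖windowKernel h x‖ ^ 2 ≤ 2 * h ^ 2 * (1 + (x * (h / 2)) ^ 2)⁻¹ := by
  have h1 : ‖windowKernel h x‖ ≤ h := by
    have := intervalIntegral.norm_integral_le_of_norm_le_const (a := 0) (b := h) (C := 1)
      (f := fun v : ℝ ↦ exp (-(v * x : ℝ) * I)) fun v _ ↦ by
        rw [← ofReal_neg, norm_exp_ofReal_mul_I]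
    simpa [windowKernel, abs_of_pos hh] using this
  have h2 : ‖windowKernel h x‖ * |x| ≤ 2 := by
    rcases eq_or_ne x 0 with rfl | hx
    · simp
    have hc : -(x : ℂ) * I ≠ 0 := by simp [hx]
    have h3 : windowKernel h x = (exp (-(x : ℂ) * I * h) - exp (-(x : ℂ) * I * (0 : ℝ))) /
        (-(x : ℂ) * I) := by
      rw [← integral_exp_mul_complex hc, windowKernel]
      congr 1 with v
      congr 1
      push_cast; ring
    have h4 : ‖-(x : ℂ) * I‖ = |x| := by simp
    rw [h3, norm_div, h4, div_mul_cancel₀ _ (abs_ne_zero.2 hx)]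
    refine (norm_sub_le _ _).trans ?_
    rw [show -(x : ℂ) * I * h = (-x * h : ℝ) * I by push_cast; ring,
      show -(x : ℂ) * I * (0 : ℝ) = (0 : ℝ) * I by push_cast; ring,
      norm_exp_ofReal_mul_I, norm_exp_ofReal_mul_I]
    norm_num
  rw [← div_eq_mul_inv, le_div_iff₀ (by positivity)]
  have h5 : ‖windowKernel h x‖ ^ 2 ≤ h ^ 2 := by gcongr
  have h6 : ‖windowKernel h x‖ ^ 2 * x ^ 2 ≤ 4 := by
    have : (‖windowKernel h x‖ * |x|) ^ 2 ≤ 2 ^ 2 := by gcongr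
    rw [mul_pow, sq_abs] at this
    linarith
  nlinarith [mul_le_mul_of_nonneg_right h6 (sq_nonneg h)]

/-- By Fubini, integrating a Fourier transform over a window multiplies the original function by
`windowKernel`, so Plancherel applies to the windowed integral as well. -/
theorem intervalIntegral_fourier_eq {g : ℝ → ℂ} (hg : Integrable g) (t h : ℝ) :
    ∫ u in t..t + h, 𝓕 g (u / (2 * Real.pi)) =
      𝓕 (fun x ↦ windowKernel h x * g x) (t / (2 * Real.pi)) := by
  have hF (f : ℝ → ℂ) (u : ℝ) : 𝓕 f (u / (2 * Real.pi)) =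
      ∫ x, exp (-(u * x : ℝ) * I) * f x := by
    rw [Real.fourier_real_eq_integral_exp_smul]
    congr 1 with x
    rw [smul_eq_mul]
    congr 3
    push_cast
    have : (Real.pi : ℂ) ≠ 0 := ofReal_ne_zero.2 Real.pi_ne_zero
    field_simp
  simp_rw [hF]
  have hshift := intervalIntegral.integral_comp_add_left (a := 0) (b := h)
    (fun u : ℝ ↦ ∫ x, exp (-(u * x : ℝ) * I) * g x) t
  rw [add_zero] at hshift
  rw [← hshift, intervalIntegral_integral_swap]
  · congr 1 with x
    rw [windowKernel, ← mul_assoc, ← intervalIntegral.integral_const_mul,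
      ← intervalIntegral.integral_mul_const]
    congr 1 with v
    rw [← exp_add]
    congr 2
    push_cast; ring
  · have : IsFiniteMeasure (volume.restrict (Set.uIoc 0 h)) := ⟨by simp⟩
    have h1 : Integrable (Function.uncurry fun (_ : ℝ) (x : ℝ) ↦ g x)
        ((volume.restrict (Set.uIoc 0 h)).prod volume) := hg.comp_snd _
    refine h1.bdd_mul (c := 1) ?_ (.of_forall fun p ↦ ?_)
    · exact (by fun_prop : Continuous fun p : ℝ × ℝ ↦
        exp (-((t + p.1) * p.2 : ℝ) * I)).aestronglyMeasurable
    · rw [← ofReal_neg, norm_exp_ofReal_mul_I]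

theorem integral_inv_one_add_mul_sq {a : ℝ} (ha : 0 < a) :
    Integrable (fun x : ℝ ↦ (1 + (x * a) ^ 2)⁻¹) ∧
      ∫ x : ℝ, (1 + (x * a) ^ 2)⁻¹ = Real.pi / a := by
  refine ⟨integrable_inv_one_add_sq.comp_mul_right' ha.ne', ?_⟩
  rw [Measure.integral_comp_mul_right (fun x ↦ (1 + x ^ 2)⁻¹), integral_univ_inv_one_add_sq,
    abs_of_pos (by positivity), smul_eq_mul, div_eq_inv_mul]

/-- Mean square of the integrals over short intervals of the rotated Mellin transform. -/
theorem CuspidalOnHalfPlane.integral_norm_window_sq_le {k : ℝ} {F : ℂ → ℂ}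
    (hF : CuspidalOnHalfPlane k F) : ∃ C : ℝ, 0 ≤ C ∧ ∀ φ : ℝ, 0 < Real.cos φ →
    ∀ h : ℝ, 0 < h →
    Integrable (fun t : ℝ ↦ ‖∫ u in t..t + h, mellin (fun t : ℝ ↦ F (exp (φ * I) * t))
      ((k / 2 : ℝ) + u * I)‖ ^ 2) ∧
    ∫ t : ℝ, ‖∫ u in t..t + h, mellin (fun t : ℝ ↦ F (exp (φ * I) * t))
      ((k / 2 : ℝ) + u * I)‖ ^ 2 ≤ C * Real.cos φ ^ (-k) * h := by
  obtain ⟨C, hC₀, hC⟩ := hF.norm_mellinKernel_le le_rfl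
  refine ⟨2 * Real.pi * (C ^ 2 * (4 * Real.pi)), by positivity, fun φ hφ h hh ↦ ?_⟩
  simp_rw [mellin_rotate_eq_fourier]
  have hg := hF.integrable_mellinKernel hφ (k / 2)
  simp_rw [intervalIntegral_fourier_eq hg]
  set G : ℝ → ℂ := fun x ↦ windowKernel h x * mellinKernel F φ (k / 2) x
  have hcont : Continuous G := (continuous_windowKernel h).mul (hF.continuous_mellinKernel hφ _)
  have hw (x : ℝ) : ‖windowKernel h x‖ ≤ 2 * h := by
    have h1 := norm_windowKernel_sq_le hh x
    have h2 : (1 + (x * (h / 2)) ^ 2)⁻¹ ≤ 1 := inv_le_one_of_one_le₀ (by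
      have := sq_nonneg (x * (h / 2)); linarith)
    have h3 := mul_le_mul_of_nonneg_left h2 (show 0 ≤ 2 * h ^ 2 by positivity)
    exact le_of_sq_le_sq (by nlinarith) (by positivity)
  have hG1 : Integrable G :=
    hg.bdd_mul (c := 2 * h) (continuous_windowKernel h).aestronglyMeasurable (.of_forall hw)
  obtain ⟨hi, hv⟩ := integral_inv_one_add_mul_sq (half_pos hh)
  -- On the line k/2 itself (β = 0, M = 0) the Mellin kernel is bounded by C cos(φ)^{-k/2}; the
  -- decay used here comes from the window.
  have hGle (x : ℝ) : ‖G x‖ ^ 2 ≤ C ^ 2 * Real.cos φ ^ (-k) * (2 * h ^ 2) *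
      (1 + (x * (h / 2)) ^ 2)⁻¹ := by
    have h1 := hC φ hφ 0 x le_rfl
    rw [add_zero, neg_zero, Real.rpow_zero, mul_one, zero_mul, Real.exp_zero, mul_one] at h1
    rw [norm_mul, mul_pow]
    calc _ ≤ (2 * h ^ 2 * (1 + (x * (h / 2)) ^ 2)⁻¹) * (C * Real.cos φ ^ (-k / 2)) ^ 2 := by
          gcongr
          exact norm_windowKernel_sq_le hh x
      _ = _ := by
        rw [mul_pow C, ← Real.rpow_mul_natCast hφ.le]
        push_cast
        rw [div_mul_cancel₀ _ two_ne_zero]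
        ring
  have hG2i : Integrable fun x ↦ ‖G x‖ ^ 2 :=
    (hi.const_mul (C ^ 2 * Real.cos φ ^ (-k) * (2 * h ^ 2))).mono'
      (hcont.norm.pow 2).aestronglyMeasurable (.of_forall fun x ↦ by
        rw [Real.norm_of_nonneg (by positivity)]; exact hGle x)
  have hG2 : MemLp G 2 :=
    (memLp_two_iff_integrable_sq_norm hcont.aestronglyMeasurable).2 hG2i
  refine ⟨((memLp_fourier hG1 hG2).integrable_norm_pow two_ne_zero).comp_div (by positivity), ?_⟩
  rw [Measure.integral_comp_div (fun ξ ↦ ‖𝓕 G ξ‖ ^ 2), integral_norm_fourier_sq_eq hG1 hG2,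
    abs_of_pos Real.two_pi_pos, smul_eq_mul, mul_assoc (2 * Real.pi), mul_assoc (2 * Real.pi)]
  gcongr
  calc _ ≤ ∫ x, C ^ 2 * Real.cos φ ^ (-k) * (2 * h ^ 2) * (1 + (x * (h / 2)) ^ 2)⁻¹ :=
        integral_mono hG2i (hi.const_mul _) hGle
    _ = _ := by
      rw [integral_const_mul, hv]
      field_simp
      ring

end HalfPlane

/-! ### Mellin transforms, Dirichlet series and entire continuation -/

section MellinDirichlet

open MeasureTheory Complex Set

/-- Both sides are holomorphic in r on the right half-plane and agree for real r > 0, so the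
identity theorem at r = 1 suffices. -/
theorem integral_cpow_mul_exp_neg_mul_complex {s r : ℂ} (hs : 0 < s.re) (hr : 0 < r.re) :
    ∫ t : ℝ in Ioi 0, (t : ℂ) ^ (s - 1) * exp (-(r * t)) = (1 / r) ^ s * Gamma s := by
  have hmeas {g : ℂ → ℝ → ℂ} (hg : ∀ r, Continuous (g r)) (r : ℂ) : AEStronglyMeasurable
      (fun t : ℝ ↦ (t : ℂ) ^ (s - 1) * g r t) (volume.restrict (Ioi 0)) := by
    refine ContinuousOn.aestronglyMeasurable (fun t ht ↦ ContinuousAt.continuousWithinAt ?_)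
      measurableSet_Ioi
    exact (continuousAt_ofReal_cpow_const _ _ (Or.inr (ne_of_gt ht))).mul (hg r).continuousAt
  have hnorm (r : ℂ) {t : ℝ} (ht : 0 < t) : ‖(t : ℂ) ^ (s - 1) * exp (-(r * t))‖ =
      t ^ (s.re - 1) * Real.exp (-(r.re * t)) := by
    rw [norm_mul, norm_exp, norm_cpow_eq_rpow_re_of_pos ht, sub_re, one_re, neg_re, re_mul_ofReal]
  have hint {r : ℂ} (hr : 0 < r.re) :
      IntegrableOn (fun t : ℝ ↦ (t : ℂ) ^ (s - 1) * exp (-(r * t))) (Ioi 0) := by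
    refine Integrable.mono' (integrableOn_rpow_mul_exp_neg_mul_rpow (s := s.re - 1) (by linarith)
      one_pos hr) (hmeas (g := fun r t ↦ exp (-(r * t))) (by fun_prop) r) ?_
    refine (ae_restrict_iff' measurableSet_Ioi).2 (.of_forall fun t ht ↦ le_of_eq ?_)
    rw [hnorm r ht, Real.rpow_one, neg_mul]
  have hdiff : DifferentiableOn ℂ
      (fun r : ℂ ↦ ∫ t : ℝ in Ioi 0, (t : ℂ) ^ (s - 1) * exp (-(r * t))) {r | 0 < r.re} := by
    intro r₀ hr₀
    have hr₀ : 0 < r₀.re := hr₀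
    have hball {r : ℂ} (h : r ∈ Metric.ball r₀ (r₀.re / 2)) : r₀.re / 2 ≤ r.re := by
      have h1 := (abs_re_le_norm (r - r₀)).trans (mem_ball_iff_norm.1 h).le
      rw [sub_re] at h1
      linarith [(abs_le.1 h1).1]
    refine (hasDerivAt_integral_of_dominated_loc_of_deriv_le (𝕜 := ℂ)
      (F := fun r (t : ℝ) ↦ (t : ℂ) ^ (s - 1) * exp (-(r * t)))
      (F' := fun r (t : ℝ) ↦ (t : ℂ) ^ (s - 1) * (exp (-(r * t)) * -t))
      (bound := fun t ↦ t ^ s.re * Real.exp (-(r₀.re / 2) * t ^ (1 : ℝ)))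
      (Metric.ball_mem_nhds r₀ (half_pos hr₀))
      (.of_forall (hmeas (g := fun r t ↦ exp (-(r * t))) (by fun_prop))) (hint hr₀)
      (hmeas (g := fun r t ↦ exp (-(r * t)) * -t) (by fun_prop) r₀) ?_
      (integrableOn_rpow_mul_exp_neg_mul_rpow (by linarith) one_pos (half_pos hr₀))
      ?_).2.differentiableAt.differentiableWithinAt
    · refine (ae_restrict_iff' measurableSet_Ioi).2 (.of_forall fun t ht r hr ↦ ?_)
      have ht : 0 < t := ht
      rw [← mul_assoc, norm_mul, hnorm r ht, norm_neg, norm_real, Real.norm_of_nonneg ht.le,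
        Real.rpow_one, mul_right_comm, ← Real.rpow_add_one ht.ne', sub_add_cancel, neg_mul]
      gcongr
      exact hball hr
    · refine .of_forall fun t r _ ↦ HasDerivAt.const_mul _ ?_
      have h1 : HasDerivAt (fun r : ℂ ↦ -(r * t)) (-t) r := by
        simpa using ((hasDerivAt_id' r).mul_const (t : ℂ)).fun_neg
      exact h1.cexp
  have hop : IsOpen {r : ℂ | 0 < r.re} := isOpen_lt continuous_const continuous_re
  have hrhs : DifferentiableOn ℂ (fun r : ℂ ↦ (1 / r) ^ s * Gamma s) {r | 0 < r.re} := by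
    intro r hr
    have hr : 0 < r.re := hr
    have hr0 : r ≠ 0 := fun h ↦ by simp [h] at hr
    refine (((differentiableAt_const _).div differentiableAt_id hr0).cpow_const ?_ |>.mul_const
      _).differentiableWithinAt
    left
    change 0 < ((1 : ℂ) / r).re
    rw [one_div, inv_re]
    exact div_pos hr (normSq_pos.2 hr0)
  refine (hdiff.analyticOnNhd hop).eqOn_of_preconnected_of_frequently_eq (hrhs.analyticOnNhd hop)
    (convex_halfSpace_re_gt 0).isPreconnected (z₀ := 1) (by simp) ?_ hr
  have h1 : Filter.Tendsto (fun x : ℝ ↦ (x : ℂ)) (nhdsWithin 1 {1}ᶜ) (nhdsWithin 1 {1}ᶜ) := by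
    refine tendsto_nhdsWithin_of_tendsto_nhds_of_eventually_within _ ?_ ?_
    · exact (continuous_ofReal.tendsto' 1 1 ofReal_one).mono_left nhdsWithin_le_nhds
    · filter_upwards [self_mem_nhdsWithin] with x hx
      simpa using hx
  refine h1.frequently (Filter.Eventually.frequently ?_)
  filter_upwards [mem_nhdsWithin_of_mem_nhds (Ioi_mem_nhds one_pos)] with x hx
  exact Complex.integral_cpow_mul_exp_neg_mul_Ioi hs hx

theorem one_div_rotate_cpow {l φ : ℝ} (hl : 0 < l) (hφ : |φ| < Real.pi / 2) {n : ℕ} (hn : n ≠ 0)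
    (s : ℂ) : (1 / (l * n * exp (φ * I))) ^ s = exp (-(φ * I * s)) * l ^ (-s) / n ^ s := by
  have hn' : (0 : ℝ) < n := by positivity
  have hlC : (l : ℂ) ≠ 0 := ofReal_ne_zero.2 hl.ne'
  have hnC : (n : ℂ) ≠ 0 := Nat.cast_ne_zero.2 hn
  have h1 : 1 / (l * n * exp (φ * I)) = ((l * n)⁻¹ : ℝ) * exp (-(φ * I)) := by
    rw [exp_neg]; push_cast; field_simp
  have h2 : log (exp (-(φ * I))) = -(φ * I) := by
    rw [abs_lt] at hφ
    apply log_exp <;> simp <;> linarith [Real.pi_pos]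
  rw [h1, cpow_def_of_ne_zero (mul_ne_zero (by simp [hl.ne', hn]) (exp_ne_zero _)),
    log_ofReal_mul (by positivity) (exp_ne_zero _), h2, Real.log_inv,
    Real.log_mul hl.ne' hn'.ne', cpow_def_of_ne_zero hlC, cpow_def_of_ne_zero hnC,
    ← exp_add, ← exp_sub, ← ofReal_log hl.le, ← natCast_log]
  congr 1
  push_cast
  ring

/-- The Mellin transform along a ray of a function given by an exponential series. -/
theorem mellin_rotate_eq_LSeries {a : ℕ → ℂ} (ha0 : a 0 = 0) {l : ℝ} (hl : 0 < l) {F : ℂ → ℂ}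
    (hF : ∀ w : ℂ, 0 < w.re → HasSum (fun n : ℕ ↦ a n * exp (-(l * n * w))) (F w)) {φ : ℝ}
    (hφ : |φ| < Real.pi / 2) {s : ℂ} (hs : 0 < s.re) (hsum : LSeriesSummable a s) :
    mellin (fun t : ℝ ↦ F (exp (φ * I) * t)) s =
      exp (-(φ * I * s)) * l ^ (-s) * Gamma s * LSeries a s := by
  have hcos : 0 < Real.cos φ := Real.cos_pos_of_mem_Ioo ⟨(abs_lt.1 hφ).1, (abs_lt.1 hφ).2⟩
  set f : ℕ → ℝ → ℂ := fun n t ↦ (t : ℂ) ^ (s - 1) * (a n * exp (-(l * n * (exp (φ * I) * t))))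
  have hnorm (n : ℕ) {t : ℝ} (ht : 0 < t) : ‖f n t‖ =
      ‖a n‖ * (t ^ (s.re - 1) * Real.exp (-(l * n * Real.cos φ * t))) := by
    have : (-(l * n * (exp (φ * I) * t)) : ℂ).re = -(l * n * Real.cos φ * t) := by
      rw [show (-(l * n * (exp (φ * I) * t)) : ℂ) = ((-(l * n * t) : ℝ) : ℂ) * exp (φ * I) by
        push_cast; ring, re_ofReal_mul, exp_ofReal_mul_I_re]
      ring
    rw [norm_mul, norm_mul, norm_exp, this, norm_cpow_eq_rpow_re_of_pos ht, sub_re, one_re]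
    ring
  have hpos {n : ℕ} (hn : n ≠ 0) : 0 < l * n * Real.cos φ := by positivity
  have hint (n : ℕ) : IntegrableOn (f n) (Ioi 0) := by
    rcases eq_or_ne n 0 with rfl | hn
    · simp [f, ha0]
    have h1 := (integrableOn_rpow_mul_exp_neg_mul_rpow (s := s.re - 1) (by linarith) one_pos
      (hpos hn)).const_mul ‖a n‖
    refine Integrable.mono' h1 ?_ ?_
    · refine ContinuousOn.aestronglyMeasurable (fun t ht ↦ ContinuousAt.continuousWithinAt ?_)
        measurableSet_Ioi
      exact (continuousAt_ofReal_cpow_const _ _ (Or.inr (ne_of_gt ht))).mul (by fun_prop)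
    · refine (ae_restrict_iff' measurableSet_Ioi).2 (.of_forall fun t ht ↦ le_of_eq ?_)
      rw [hnorm n ht, Real.rpow_one, neg_mul]
  have hval (n : ℕ) : ∫ t in Ioi (0 : ℝ), ‖f n t‖ =
      (l * Real.cos φ) ^ (-s.re) * Real.Gamma s.re * ‖LSeries.term a s n‖ := by
    rcases eq_or_ne n 0 with rfl | hn
    · simp [f, ha0]
    rw [setIntegral_congr_fun measurableSet_Ioi fun t ht ↦ hnorm n ht, integral_const_mul,
      Real.integral_rpow_mul_exp_neg_mul_Ioi hs (hpos hn), LSeries.norm_term_eq, if_neg hn,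
      Real.rpow_neg (by positivity), one_div, Real.inv_rpow (hpos hn).le, mul_right_comm l,
      Real.mul_rpow (by positivity) (by positivity)]
    field_simp
  have hsm : Summable fun n ↦ ∫ t in Ioi (0 : ℝ), ‖f n t‖ := by
    simp_rw [hval]
    exact hsum.norm.mul_left _
  have h := hasSum_integral_of_summable_integral_norm hint hsm
  have hterm (n : ℕ) : ∫ t in Ioi (0 : ℝ), f n t =
      exp (-(φ * I * s)) * l ^ (-s) * Gamma s * LSeries.term a s n := by
    rcases eq_or_ne n 0 with rfl | hn
    · simp [f, ha0]
    have hr : 0 < (l * n * exp (φ * I) : ℂ).re := by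
      rw [show (l * n * exp (φ * I) : ℂ) = ((l * n : ℝ) : ℂ) * exp (φ * I) by push_cast; ring,
        re_ofReal_mul, exp_ofReal_mul_I_re]
      exact hpos hn
    have h1 := integral_cpow_mul_exp_neg_mul_complex hs hr
    rw [one_div_rotate_cpow hl hφ hn] at h1
    rw [LSeries.term_of_ne_zero hn]
    calc _ = ∫ t in Ioi (0 : ℝ), a n * ((t : ℂ) ^ (s - 1) * exp (-(l * n * exp (φ * I) * t))) := by
          congr 1 with t
          simp only [f]
          rw [mul_assoc (l * n : ℂ)]
          ring
      _ = _ := by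
        rw [integral_const_mul, h1]
        ring
  simp_rw [hterm] at h
  have h2 : mellin (fun t : ℝ ↦ F (exp (φ * I) * t)) s = ∫ t in Ioi (0 : ℝ), ∑' n, f n t := by
    refine setIntegral_congr_fun measurableSet_Ioi fun t ht ↦ ?_
    have ht : 0 < t := ht
    simp only [smul_eq_mul, f]
    rw [tsum_mul_left, (hF _ _).tsum_eq]
    rw [re_mul_ofReal, exp_ofReal_mul_I_re]
    positivity
  rw [h2, ← h.tsum_eq, tsum_mul_left, LSeries]

theorem Differentiable.eq_of_eqOn_halfPlane {f g : ℂ → ℂ} (hf : Differentiable ℂ f)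
    (hg : Differentiable ℂ g) {x : ℝ} (h : ∀ s : ℂ, x < s.re → f s = g s) : f = g := by
  have hf' : AnalyticOnNhd ℂ f univ := fun z _ ↦ hf.analyticAt z
  have hg' : AnalyticOnNhd ℂ g univ := fun z _ ↦ hg.analyticAt z
  refine hf'.eq_of_eventuallyEq hg' (z₀ := (x + 1 : ℝ)) ?_
  filter_upwards [(isOpen_lt continuous_const continuous_re).mem_nhds
    (show x < ((x + 1 : ℝ) : ℂ).re by simp)] with s hs
  exact h s hs

/-- The definition asks for equality on the whole half-plane of absolute convergence. That set is
convex, so agreement far to the right propagates to it. -/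
theorem isEntireContinuation_of_eq_halfPlane {a : ℕ → ℂ} (ha : LSeries.abscissaOfAbsConv a < ⊤)
    {L : ℂ → ℂ} (hL : Differentiable ℂ L) {x : ℝ} (h : ∀ s : ℂ, x < s.re → L s = LSeries a s) :
    IsEntireContinuation a L := by
  refine ⟨ha, hL, fun s hs ↦ ?_⟩
  have hop : IsOpen {s : ℂ | LSeries.abscissaOfAbsConv a < s.re} :=
    isOpen_lt continuous_const (continuous_coe_real_ereal.comp continuous_re)
  have hconv : IsPreconnected {s : ℂ | LSeries.abscissaOfAbsConv a < s.re} := by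
    refine Convex.isPreconnected fun s hs t ht c d hc hd hcd ↦ ?_
    have h1 : min s.re t.re ≤ (c • s + d • t).re := by
      simp only [add_re, real_smul, re_ofReal_mul]
      have h2 := mul_le_mul_of_nonneg_left (min_le_left s.re t.re) hc
      have h3 := mul_le_mul_of_nonneg_left (min_le_right s.re t.re) hd
      have h4 : min s.re t.re = c * min s.re t.re + d * min s.re t.re := by
        rw [← add_mul, hcd, one_mul]
      linarith
    change LSeries.abscissaOfAbsConv a < _
    refine lt_of_lt_of_le ?_ (EReal.coe_le_coe_iff.2 h1)
    rcases min_choice s.re t.re with h | h <;> rw [h] <;> assumption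
  obtain ⟨y, hy1, hy2⟩ := EReal.exists_between_coe_real ha
  have hL' : AnalyticOnNhd ℂ L {s : ℂ | LSeries.abscissaOfAbsConv a < s.re} :=
    fun z _ ↦ hL.analyticAt z
  refine hL'.eqOn_of_preconnected_of_eventuallyEq (LSeries_analyticOnNhd a) hconv
    (z₀ := (max x y + 1 : ℝ)) ?_ ?_ hs
  · change LSeries.abscissaOfAbsConv a < _
    refine hy1.trans (EReal.coe_lt_coe_iff.2 ?_)
    rw [ofReal_re]
    linarith [le_max_right x y]
  · filter_upwards [(isOpen_lt continuous_const continuous_re).mem_nhds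
      (show x < ((max x y + 1 : ℝ) : ℂ).re by rw [ofReal_re]; linarith [le_max_left x y])] with s hs
    exact h s hs

theorem IsEntireContinuation.exists_LSeriesSummable {a : ℕ → ℂ}
    (ha : LSeries.abscissaOfAbsConv a < ⊤) :
    ∃ x : ℝ, 0 < x ∧ ∀ s : ℂ, x ≤ s.re → LSeriesSummable a s ∧
      LSeries.abscissaOfAbsConv a < s.re := by
  obtain ⟨y, hy1, hy2⟩ := EReal.exists_between_coe_real ha
  refine ⟨max y 1, by positivity, fun s hs ↦ ?_⟩
  have : LSeries.abscissaOfAbsConv a < s.re :=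
    hy1.trans_le (EReal.coe_le_coe_iff.2 ((le_max_left y 1).trans hs))
  exact ⟨LSeriesSummable_of_abscissaOfAbsConv_lt_re this, this⟩

section

variable {k : ℝ} {F : ℂ → ℂ} (hc : CuspidalOnHalfPlane k F) {a : ℕ → ℂ} (ha0 : a 0 = 0) {l : ℝ}
  (hl : 0 < l) (hF : ∀ w : ℂ, 0 < w.re → HasSum (fun n : ℕ ↦ a n * exp (-(l * n * w))) (F w))
include hc ha0 hl hF

omit ha0 hF in
-- The Mellin transform is entire because F decays rapidly at both ends of the ray, and 1/Γ is
-- entire, so no poles occur.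
theorem differentiable_completed_div {φ : ℝ} (hφ : |φ| < Real.pi / 2) :
    Differentiable ℂ fun s ↦ exp (φ * I * s) * l ^ s * (Gamma s)⁻¹ *
      mellin (fun t : ℝ ↦ F (exp (φ * I) * t)) s := by
  have hlC : (l : ℂ) ≠ 0 := ofReal_ne_zero.2 hl.ne'
  have h1 : Differentiable ℂ fun s : ℂ ↦ exp (φ * I * s) := by fun_prop
  exact ((h1.mul (differentiable_id.const_cpow (Or.inl hlC))).mul differentiable_one_div_Gamma).mul
    (hc.differentiable_mellin (Real.cos_pos_of_mem_Ioo ⟨(abs_lt.1 hφ).1, (abs_lt.1 hφ).2⟩))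

omit hc in
theorem completed_div_eq_LSeries {φ : ℝ} (hφ : |φ| < Real.pi / 2) {s : ℂ} (hs : 0 < s.re)
    (hsum : LSeriesSummable a s) :
    exp (φ * I * s) * l ^ s * (Gamma s)⁻¹ * mellin (fun t : ℝ ↦ F (exp (φ * I) * t)) s =
      LSeries a s := by
  have hlC : (l : ℂ) ≠ 0 := ofReal_ne_zero.2 hl.ne'
  have hG := Gamma_ne_zero_of_re_pos hs
  have hls : (l : ℂ) ^ s ≠ 0 := by simp [cpow_eq_zero_iff, hlC]
  rw [mellin_rotate_eq_LSeries ha0 hl hF hφ hs hsum, exp_neg, cpow_neg]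
  have := exp_ne_zero (φ * I * s)
  field_simp

/-- The entire continuation of a Dirichlet series from its Mellin transform. -/
theorem exists_isEntireContinuation (ha : LSeries.abscissaOfAbsConv a < ⊤) :
    ∃ L, IsEntireContinuation a L := by
  obtain ⟨x, hx0, hx⟩ := IsEntireContinuation.exists_LSeriesSummable ha
  have h0 : |(0 : ℝ)| < Real.pi / 2 := by rw [abs_zero]; positivity
  exact ⟨_, isEntireContinuation_of_eq_halfPlane ha (differentiable_completed_div hc hl h0)
    (x := x) fun s hs ↦ completed_div_eq_LSeries ha0 hl hF h0 (hx0.trans hs) (hx s hs.le).1⟩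

/-- This replaces a rotation of the contour: for each φ the right side is entire and equals the
Dirichlet series far to the right, so it does not depend on φ. -/
theorem IsEntireContinuation.eq_completed_div {L : ℂ → ℂ} (hL : IsEntireContinuation a L) {φ : ℝ}
    (hφ : |φ| < Real.pi / 2) (s : ℂ) : L s = exp (φ * I * s) * l ^ s * (Gamma s)⁻¹ *
      mellin (fun t : ℝ ↦ F (exp (φ * I) * t)) s := by
  obtain ⟨x, hx0, hx⟩ := IsEntireContinuation.exists_LSeriesSummable hL.abscissa_lt_top
  refine congrFun (hL.differentiable.eq_of_eqOn_halfPlane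
    (differentiable_completed_div hc hl hφ) (x := x) fun s hs ↦ ?_) s
  rw [completed_div_eq_LSeries ha0 hl hF hφ (hx0.trans hs) (hx s hs.le).1]
  exact hL.eq_LSeries s (hx s hs.le).2

end

end MellinDirichlet

/-! ### The rotated transform on and near the critical line -/

section CriticalLine

open MeasureTheory Complex Set

theorem Real.rpow_le_rpow_abs_mul {x y A : ℝ} (hx : 0 < x) (hy : 0 < y) (hA : 1 ≤ A)
    (h1 : x ≤ A * y) (h2 : y ≤ A * x) (p : ℝ) : x ^ p ≤ A ^ |p| * y ^ p := by
  have hA0 : 0 < A := by linarith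
  rcases le_total 0 p with hp | hp
  · rw [abs_of_nonneg hp, ← Real.mul_rpow hA0.le hy.le]
    exact Real.rpow_le_rpow hx.le h1 hp
  · rw [abs_of_nonpos hp, Real.rpow_neg hA0.le, ← div_eq_inv_mul, ← Real.div_rpow hy.le hA0.le]
    exact Real.rpow_le_rpow_of_nonpos (by positivity) (by rw [div_le_iff₀ hA0]; linarith) hp

theorem abs_pi_div_two_sub_inv_lt {T : ℝ} (hT : 1 ≤ T) : |Real.pi / 2 - T⁻¹| < Real.pi / 2 := by
  have h1 : T⁻¹ ≤ 1 := inv_le_one_of_one_le₀ hT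
  have h2 : 0 < T⁻¹ := by positivity
  rw [abs_lt]
  constructor <;> linarith [Real.pi_gt_three]

theorem cos_pi_div_two_sub_inv_pos {T : ℝ} (hT : 1 ≤ T) : 0 < Real.cos (Real.pi / 2 - T⁻¹) :=
  Real.cos_pos_of_mem_Ioo ⟨(abs_lt.1 (abs_pi_div_two_sub_inv_lt hT)).1,
    (abs_lt.1 (abs_pi_div_two_sub_inv_lt hT)).2⟩

/-- Here cos φ = sin(1/T) lies between 1/(2T) and 2/T, which handles either sign of p. -/
theorem cos_rpow_le {T : ℝ} (hT : 1 ≤ T) (p : ℝ) :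
    Real.cos (Real.pi / 2 - T⁻¹) ^ (-p) ≤ 2 ^ |p| * T ^ p := by
  have hT0 : 0 < T := by linarith
  have h := Real.rpow_le_rpow_abs_mul (cos_pi_div_two_sub_inv_pos hT) (inv_pos.2 hT0)
    one_le_two ?_ ?_ (-p)
  · rwa [abs_neg, Real.inv_rpow hT0.le, Real.rpow_neg hT0.le, inv_inv] at h
  · rw [Real.cos_pi_div_two_sub]
    have := Real.sin_le (inv_pos.2 hT0).le
    linarith [inv_pos.2 hT0]
  · rw [Real.cos_pi_div_two_sub]
    have h1 : T⁻¹ ≤ 1 := inv_le_one_of_one_le₀ hT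
    have h2 := Real.mul_le_sin (inv_pos.2 hT0).le (by linarith [Real.pi_gt_three])
    have h3 : 1 / 2 ≤ 2 / Real.pi := by
      rw [div_le_div_iff₀ two_pos Real.pi_pos]
      linarith [Real.pi_le_four]
    nlinarith [inv_pos.2 hT0]

theorem continuous_intervalIntegral_add {f : ℝ → ℝ} (hf : Continuous f) (h : ℝ) :
    Continuous fun t ↦ ∫ u in t..t + h, f u := by
  have h1 : (fun t ↦ ∫ u in t..t + h, f u) = fun t ↦ ∫ v in (0 : ℝ)..h, f (t + v) := by
    ext t
    rw [intervalIntegral.integral_comp_add_left, add_zero]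
  rw [h1]
  exact intervalIntegral.continuous_parametric_intervalIntegral_of_continuous'
    (f := fun t v ↦ f (t + v)) (by fun_prop) 0 h

section

variable {k : ℝ} {F : ℂ → ℂ} (hc : CuspidalOnHalfPlane k F) {a : ℕ → ℂ} (ha0 : a 0 = 0) {l : ℝ}
  (hl : 0 < l) (hF : ∀ w : ℂ, 0 < w.re → HasSum (fun n : ℕ ↦ a n * exp (-(l * n * w))) (F w))
  {L : ℂ → ℂ} (hL : IsEntireContinuation a L)
include hc ha0 hl hF hL

theorem mellin_rotate_eq_entire {φ : ℝ} (hφ : |φ| < Real.pi / 2) {s : ℂ} (hs : Gamma s ≠ 0) :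
    mellin (fun t : ℝ ↦ F (exp (φ * I) * t)) s =
      exp (-(φ * I * s)) * l ^ (-s) * Gamma s * L s := by
  have hlC : (l : ℂ) ≠ 0 := ofReal_ne_zero.2 hl.ne'
  have hls : (l : ℂ) ^ s ≠ 0 := by simp [cpow_eq_zero_iff, hlC]
  rw [hL.eq_completed_div hc ha0 hl hF hφ s, exp_neg, cpow_neg]
  have := exp_ne_zero (φ * I * s)
  field_simp

omit hc ha0 hl hF hL in
theorem Gamma_ne_zero_of_im_ne_zero {s : ℂ} (hs : s.im ≠ 0) : Gamma s ≠ 0 :=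
  Gamma_ne_zero fun m h ↦ hs (by simp [h])

/-- With φ = π/2 - 1/T one has |e^{-iφs}| = e^{φu}, which cancels the factor e^{-πu/2} of Γ up to
e^{-u/T} ≥ e^{-3}. What remains of Γ is u^{σ - 1/2}, comparable to T^{σ - 1/2}. -/
theorem le_norm_mellin_rotate (σ₀ σ₁ : ℝ) : ∃ c : ℝ, 0 < c ∧ ∀ T : ℝ, 1 ≤ T → ∀ σ u : ℝ,
    σ₀ ≤ σ → σ ≤ σ₁ → T ≤ u → u ≤ 3 * T → c * T ^ (σ - 1 / 2) * ‖L (σ + u * I)‖ ≤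
      ‖mellin (fun t : ℝ ↦ F (exp ((Real.pi / 2 - T⁻¹ : ℝ) * I) * t)) (σ + u * I)‖ := by
  obtain ⟨c, hc0, h⟩ := exists_le_norm_Gamma σ₀ σ₁
  set D := |σ₀| + |σ₁|
  refine ⟨Real.exp (-3) * Real.exp (-(D * |Real.log l|)) * (c / 3 ^ (D + 1)), by positivity,
    fun T hT σ u h0 h1 hu1 hu3 ↦ ?_⟩
  have hT0 : 0 < T := by linarith
  have hu : 0 < u := by linarith
  have hσD : |σ| ≤ D := by
    rw [abs_le]
    constructor
    · linarith [neg_abs_le σ₀, abs_nonneg σ₁]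
    · linarith [le_abs_self σ₁, abs_nonneg σ₀]
  have him : ((σ : ℂ) + u * I).im = u := by simp
  have hre : ((σ : ℂ) + u * I).re = σ := by simp
  rw [mellin_rotate_eq_entire hc ha0 hl hF hL (abs_pi_div_two_sub_inv_lt hT)
    (Gamma_ne_zero_of_im_ne_zero (by rw [him]; exact hu.ne')), norm_mul, norm_mul, norm_mul,
    norm_exp, norm_cpow_eq_rpow_re_of_pos hl, neg_re, neg_re, hre]
  have hre2 : (((Real.pi / 2 - T⁻¹ : ℝ) : ℂ) * I * (σ + u * I)).re = -((Real.pi / 2 - T⁻¹) * u) := by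
    rw [mul_assoc, re_ofReal_mul]; simp
  rw [hre2, neg_neg]
  have e1 : Real.exp (-3) ≤ Real.exp ((Real.pi / 2 - T⁻¹) * u) * Real.exp (-(Real.pi * u / 2)) := by
    rw [← Real.exp_add, Real.exp_le_exp]
    have : T⁻¹ * u ≤ 3 := by rw [inv_mul_le_iff₀ hT0]; linarith
    linarith
  have e2 : Real.exp (-(D * |Real.log l|)) ≤ l ^ (-σ) := by
    rw [Real.rpow_def_of_pos hl, Real.exp_le_exp]
    have := (le_abs_self (Real.log l * σ)).trans_eq (abs_mul _ _)
    have h3 := mul_le_mul_of_nonneg_left hσD (abs_nonneg (Real.log l))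
    linarith
  have e3 : T ^ (σ - 1 / 2) / 3 ^ (D + 1) ≤ u ^ (σ - 1 / 2) := by
    rw [div_le_iff₀ (by positivity), mul_comm]
    refine (Real.rpow_le_rpow_abs_mul hT0 hu (A := 3) (by norm_num) (by linarith) hu3 _).trans ?_
    gcongr
    · norm_num
    · refine (abs_sub _ _).trans ?_
      rw [abs_of_pos (by norm_num : (0 : ℝ) < 1 / 2)]
      linarith
  have e4 := h σ u h0 h1 (hT.trans hu1)
  calc _ = Real.exp (-3) * Real.exp (-(D * |Real.log l|)) * (c * (T ^ (σ - 1 / 2) / 3 ^ (D + 1))) *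
        ‖L (σ + u * I)‖ := by ring
    _ ≤ (Real.exp ((Real.pi / 2 - T⁻¹) * u) * Real.exp (-(Real.pi * u / 2))) * l ^ (-σ) *
        (c * u ^ (σ - 1 / 2)) * ‖L (σ + u * I)‖ := by gcongr
    _ = Real.exp ((Real.pi / 2 - T⁻¹) * u) * l ^ (-σ) *
        (c * u ^ (σ - 1 / 2) * Real.exp (-(Real.pi * u / 2))) * ‖L (σ + u * I)‖ := by ring
    _ ≤ _ := by gcongr

/-- Mean square of the entire continuation to the right of the critical line. -/
theorem setIntegral_norm_sq_le (B : ℝ) : ∃ C : ℝ, 0 ≤ C ∧ ∀ T : ℝ, 1 ≤ T → ∀ β : ℝ, 0 < β → β ≤ B →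
    ∫ u in Icc T (3 * T), ‖L ((k / 2 + β : ℝ) + u * I)‖ ^ 2 ≤ C * T / β := by
  obtain ⟨c, hc0, h⟩ := le_norm_mellin_rotate hc ha0 hl hF hL (k / 2) (k / 2 + B)
  obtain ⟨C, hC0, hC⟩ := hc.integral_norm_mellin_sq_le B
  refine ⟨C * 2 ^ (|k| + 2 * |B|) / c ^ 2, by positivity, fun T hT β hβ hβB ↦ ?_⟩
  have hT0 : 0 < T := by linarith
  have hcos := cos_pi_div_two_sub_inv_pos hT
  set φ := Real.pi / 2 - T⁻¹
  have h1 : c ^ 2 * T ^ (k + 2 * β - 1) * ∫ u in Icc T (3 * T), ‖L ((k / 2 + β : ℝ) + u * I)‖ ^ 2 ≤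
      C * (2 ^ (|k| + 2 * |B|) * T ^ (k + 2 * β)) / β := by
    rw [← integral_const_mul]
    calc _ ≤ ∫ u in Icc T (3 * T),
          ‖mellin (fun t : ℝ ↦ F (exp (φ * I) * t)) ((k / 2 + β : ℝ) + u * I)‖ ^ 2 := by
          refine setIntegral_mono_on ?_ (hc.integrable_norm_mellin_sq hcos _).integrableOn
            measurableSet_Icc fun u hu ↦ ?_
          · refine ContinuousOn.integrableOn_Icc (Continuous.continuousOn ?_)
            have := hL.differentiable.continuous
            fun_prop
          · have h2 := h T hT (k / 2 + β) u (by linarith) (by linarith) hu.1 hu.2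
            calc _ = (c * T ^ (k / 2 + β - 1 / 2) * ‖L ((k / 2 + β : ℝ) + u * I)‖) ^ 2 := by
                  rw [mul_pow, mul_pow, ← Real.rpow_mul_natCast hT0.le]
                  push_cast
                  ring_nf
              _ ≤ _ := by gcongr
      _ ≤ ∫ u : ℝ, ‖mellin (fun t : ℝ ↦ F (exp (φ * I) * t)) ((k / 2 + β : ℝ) + u * I)‖ ^ 2 :=
          setIntegral_le_integral (hc.integrable_norm_mellin_sq hcos _)
            (.of_forall fun u ↦ sq_nonneg _)
      _ ≤ C * Real.cos φ ^ (-k - 2 * β) / β := hC φ hcos β hβ hβB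
      _ ≤ _ := by
          gcongr
          rw [show -k - 2 * β = -(k + 2 * β) by ring]
          refine (cos_rpow_le hT _).trans ?_
          gcongr
          · exact one_le_two
          · refine (abs_add_le _ _).trans ?_
            rw [abs_mul, abs_of_pos hβ, abs_two]
            gcongr
            exact hβB.trans (le_abs_self B)
  rw [Real.rpow_sub_one hT0.ne'] at h1
  have hTk : 0 < T ^ (k + 2 * β) := by positivity
  rw [div_mul_eq_mul_div, div_div, le_div_iff₀ (by positivity)]
  rw [le_div_iff₀ hβ] at h1
  set J := ∫ u in Icc T (3 * T), ‖L ((k / 2 + β : ℝ) + u * I)‖ ^ 2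
  have h3 : c ^ 2 * (T ^ (k + 2 * β) / T) * J * β = (J * (c ^ 2 * β)) * (T ^ (k + 2 * β) / T) := by
    ring
  rw [h3, ← le_div_iff₀ (by positivity)] at h1
  refine h1.trans (le_of_eq ?_)
  field_simp

omit hc ha0 hl hF hL in
-- Substitute t ↦ 1/t: the exponent -s + k is the conjugate of s exactly when Re s = k/2.
theorem conj_mellin_of_symm {ε : ℂ}
    (hFE : ∀ y : ℝ, 0 < y → F (y⁻¹ : ℝ) = ε * (y ^ k : ℝ) * starRingEnd ℂ (F y)) (u : ℝ) :
    mellin (fun t : ℝ ↦ F t) ((k / 2 : ℝ) + u * I) =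
      ε * starRingEnd ℂ (mellin (fun t : ℝ ↦ F t) ((k / 2 : ℝ) + u * I)) := by
  have h := mellin_comp_inv (fun t : ℝ ↦ F t) (-((k / 2 : ℝ) + u * I))
  rw [neg_neg] at h
  nth_rewrite 1 [← h]
  rw [mellin, mellin, ← integral_conj, ← integral_const_mul]
  refine setIntegral_congr_fun measurableSet_Ioi fun t ht ↦ ?_
  have ht : 0 < t := ht
  have htC : (t : ℂ) ≠ 0 := ofReal_ne_zero.2 ht.ne'
  simp only [smul_eq_mul, map_mul]
  rw [hFE t ht]
  have h1 : starRingEnd ℂ ((t : ℂ) ^ ((k / 2 : ℝ) + u * I - 1)) =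
      (t : ℂ) ^ (-((k / 2 : ℝ) + u * I) - 1) * (t ^ k : ℝ) := by
    rw [ofReal_cpow ht.le, cpow_def_of_ne_zero htC, cpow_def_of_ne_zero htC, cpow_def_of_ne_zero htC,
      ← exp_conj, ← ofReal_log ht.le, ← exp_add]
    have h2 : starRingEnd ℂ ((k / 2 : ℝ) + u * I - 1) = (k / 2 : ℝ) - u * I - 1 := by
      simp only [map_sub, map_add, map_mul, conj_ofReal, conj_I, map_one]
      ring
    rw [map_mul, conj_ofReal, h2]
    congr 1
    push_cast
    ring
  rw [h1]
  ring

theorem exists_real_of_symm {ε : ℂ} (hε : ‖ε‖ = 1)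
    (hFE : ∀ y : ℝ, 0 < y → F (y⁻¹ : ℝ) = ε * (y ^ k : ℝ) * starRingEnd ℂ (F y)) {φ : ℝ}
    (hφ : |φ| < Real.pi / 2) : ∃ η : ℂ, ‖η‖ = 1 ∧ ∀ u : ℝ, u ≠ 0 →
    (η * mellin (fun t : ℝ ↦ F (exp (φ * I) * t)) ((k / 2 : ℝ) + u * I)).im = 0 := by
  -- A square root η of conj ε makes η times the unrotated transform equal to its own conjugate.
  -- Rotation contributes e^{-iφs}, whose phase e^{-iφk/2} is constant on the line and is removed by
  -- the second factor of the witness.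
  obtain ⟨η, hη⟩ := IsAlgClosed.exists_eq_mul_self (starRingEnd ℂ ε)
  have hη1 : ‖η‖ = 1 := by
    have := congrArg norm hη
    rw [RCLike.norm_conj, hε, norm_mul, ← sq] at this
    exact (pow_eq_one_iff_of_nonneg (norm_nonneg η) two_ne_zero).1 this.symm
  have h1 : η * starRingEnd ℂ η = 1 := by
    rw [mul_conj, normSq_eq_norm_sq, hη1]; simp
  have h2 : starRingEnd ℂ ε * ε = 1 := by
    rw [mul_comm, mul_conj, normSq_eq_norm_sq, hε]; simp
  have h3 : η * ε = starRingEnd ℂ η := by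
    have hne : η ≠ 0 := fun h ↦ by simp [h] at hη1
    apply mul_left_cancel₀ hne
    rw [h1, ← mul_assoc, ← hη, h2]
  refine ⟨η * exp (φ * I * (k / 2 : ℝ)), ?_, fun u hu ↦ ?_⟩
  · rw [norm_mul, hη1, one_mul,
      show (φ * I * (k / 2 : ℝ) : ℂ) = (φ * (k / 2) : ℝ) * I by push_cast; ring,
      norm_exp_ofReal_mul_I]
  set s : ℂ := (k / 2 : ℝ) + u * I
  have hs : Gamma s ≠ 0 := Gamma_ne_zero_of_im_ne_zero (by simpa [s] using hu)
  have h0 : |(0 : ℝ)| < Real.pi / 2 := by rw [abs_zero]; positivity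
  have e1 := mellin_rotate_eq_entire hc ha0 hl hF hL hφ hs
  have e0 := mellin_rotate_eq_entire hc ha0 hl hF hL h0 hs
  simp only [ofReal_zero, zero_mul, exp_zero, one_mul, neg_zero] at e0
  have e2 : η * exp (φ * I * (k / 2 : ℝ)) * mellin (fun t : ℝ ↦ F (exp (φ * I) * t)) s =
      (Real.exp (φ * u) : ℂ) * (η * mellin (fun t : ℝ ↦ F t) s) := by
    rw [e1, e0]
    have e3 : exp (φ * I * (k / 2 : ℝ)) * exp (-(φ * I * s)) = (Real.exp (φ * u) : ℂ) := by
      rw [← exp_add, ofReal_exp]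
      congr 1
      simp only [s]
      push_cast
      linear_combination (-(φ * u) : ℂ) * I_sq
    linear_combination (η * l ^ (-s) * Gamma s * L s) * e3
  have e4 : (η * mellin (fun t : ℝ ↦ F t) s).im = 0 := by
    rw [← conj_eq_iff_im, map_mul]
    nth_rewrite 2 [conj_mellin_of_symm hFE u]
    rw [← mul_assoc, h3]
  rw [e2, im_ofReal_mul, e4, mul_zero]

/-- Z plays the role of Hardy's function: the rotated transform times its constant phase. It depends
on T through φ, whereas c and C do not. -/
theorem exists_real_function_bounds {ε : ℂ} (hε : ‖ε‖ = 1)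
    (hFE : ∀ y : ℝ, 0 < y → F (y⁻¹ : ℝ) = ε * (y ^ k : ℝ) * starRingEnd ℂ (F y)) :
    ∃ c C : ℝ, 0 < c ∧ 0 ≤ C ∧ ∀ T : ℝ, 1 ≤ T → ∃ Z : ℝ → ℝ, Continuous Z ∧
      (∀ u ∈ Icc T (3 * T), c * T ^ ((k - 1) / 2) * ‖L ((k / 2 : ℝ) + u * I)‖ ≤ |Z u|) ∧
      (∀ u ∈ Icc T (3 * T), Z u = 0 → L ((k / 2 : ℝ) + u * I) = 0) ∧
      ∀ h : ℝ, 0 < h → ∫ t in Icc T (2 * T), (∫ u in t..t + h, Z u) ^ 2 ≤ C * T ^ k * h := by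
  obtain ⟨c, hc0, h1⟩ := le_norm_mellin_rotate hc ha0 hl hF hL (k / 2) (k / 2)
  obtain ⟨C, hC0, hC⟩ := hc.integral_norm_window_sq_le
  refine ⟨c, C * 2 ^ |k|, hc0, by positivity, fun T hT ↦ ?_⟩
  have hT0 : 0 < T := by linarith
  have hcos := cos_pi_div_two_sub_inv_pos hT
  obtain ⟨η, hη, hreal⟩ := exists_real_of_symm hc ha0 hl hF hL hε hFE
    (abs_pi_div_two_sub_inv_lt hT)
  set φ := Real.pi / 2 - T⁻¹
  set Λ : ℝ → ℂ := fun u ↦ mellin (fun t : ℝ ↦ F (exp (φ * I) * t)) ((k / 2 : ℝ) + u * I)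
  have hΛ : Continuous Λ := by
    have := (hc.differentiable_mellin hcos).continuous
    fun_prop
  have hZ (u : ℝ) (hu : u ≠ 0) : |(η * Λ u).re| = ‖Λ u‖ := by
    rw [← one_mul ‖Λ u‖, ← hη, ← norm_mul]
    exact abs_re_eq_norm.2 (hreal u hu)
  have hlow : ∀ u ∈ Icc T (3 * T), c * T ^ ((k - 1) / 2) * ‖L ((k / 2 : ℝ) + u * I)‖ ≤
      |(η * Λ u).re| := fun u hu ↦ by
    rw [hZ u (by linarith [hu.1]), sub_div]
    exact h1 T hT _ u le_rfl le_rfl hu.1 hu.2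
  have hcontZ : Continuous fun u ↦ (η * Λ u).re := continuous_re.comp (continuous_const.mul hΛ)
  refine ⟨fun u ↦ (η * Λ u).re, hcontZ, hlow, fun u hu h0 ↦ ?_, fun h hh ↦ ?_⟩
  · have h2 := hlow u hu
    have h0 : (η * Λ u).re = 0 := h0
    rw [h0, abs_zero] at h2
    have h3 : 0 < c * T ^ ((k - 1) / 2) := by positivity
    have h4 : ‖L ((k / 2 : ℝ) + u * I)‖ ≤ 0 := by
      by_contra! h5
      exact absurd h2 (not_le.2 (mul_pos h3 h5))
    exact norm_le_zero_iff.1 h4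
  · obtain ⟨hi, hle⟩ := hC φ hcos h hh
    have hpt (t : ℝ) : (∫ u in t..t + h, (η * Λ u).re) ^ 2 ≤ ‖∫ u in t..t + h, Λ u‖ ^ 2 := by
      have h5 : ∫ u in t..t + h, (η * Λ u).re = (η * ∫ u in t..t + h, Λ u).re := by
        rw [← intervalIntegral.integral_const_mul]
        exact intervalIntegral.intervalIntegral_re
          ((continuous_const.mul hΛ).intervalIntegrable _ _)
      rw [h5, ← sq_abs]
      gcongr
      refine (abs_re_le_norm _).trans ?_
      rw [norm_mul, hη, one_mul]
    calc _ ≤ ∫ t in Icc T (2 * T), ‖∫ u in t..t + h, Λ u‖ ^ 2 := by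
          refine setIntegral_mono ?_ hi.integrableOn hpt
          refine (Continuous.continuousOn ?_).integrableOn_Icc
          exact (continuous_intervalIntegral_add hcontZ h).pow 2
      _ ≤ ∫ t : ℝ, ‖∫ u in t..t + h, Λ u‖ ^ 2 :=
          setIntegral_le_integral hi (.of_forall fun u ↦ sq_nonneg _)
      _ ≤ C * Real.cos φ ^ (-k) * h := hle
      _ ≤ _ := by
          rw [mul_assoc C (2 ^ |k|)]
          gcongr
          exact cos_rpow_le hT k

end

/-- N is the index of the first nonzero coefficient. Taking absolute values termwise bounds the
remainder by that of the series with coefficients |a n| at the real point σ, which tends to 0; this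
makes the estimate uniform in u. -/
theorem exists_norm_mul_sub_le {a : ℕ → ℂ} (ha0 : a 0 = 0) (hne : ∃ n, a n ≠ 0)
    (ha : LSeries.abscissaOfAbsConv a < ⊤) : ∃ N : ℕ, 0 < N ∧ a N ≠ 0 ∧ ∃ σ₀ : ℝ,
    LSeries.abscissaOfAbsConv a < σ₀ ∧ ∀ σ : ℝ, σ₀ ≤ σ → ∀ u : ℝ,
    ‖(N : ℂ) ^ ((σ : ℂ) + u * I) * LSeries a (σ + u * I) - a N‖ ≤ ‖a N‖ / 2 := by
  classical
  set N := Nat.find hne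
  have hN : a N ≠ 0 := Nat.find_spec hne
  have hN0 : N ≠ 0 := fun h ↦ hN (h ▸ ha0)
  obtain ⟨m, hm⟩ := Nat.exists_eq_succ_of_ne_zero hN0
  set b : ℕ → ℂ := fun n ↦ (‖a n‖ : ℂ)
  have hab : LSeries.abscissaOfAbsConv b = LSeries.abscissaOfAbsConv a := by
    have h1 (s : ℂ) : LSeriesSummable b s ↔ LSeriesSummable a s := by
      rw [LSeriesSummable, LSeriesSummable, ← summable_norm_iff, ← summable_norm_iff (f := LSeries.term a s)]
      refine summable_congr fun n ↦ ?_
      simp [LSeries.norm_term_eq, b]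
    simp only [LSeries.abscissaOfAbsConv, h1]
  have hlim := LSeries.tendsto_cpow_mul_atTop (f := b) (n := m)
    (fun j hj ↦ by
      have : ¬ a j ≠ 0 := Nat.find_min hne (by omega)
      simpa [b] using this) (hab ▸ ha)
  have hNm : ((m : ℂ) + 1) = N := by rw [hm]; push_cast; rfl
  rw [hNm, show m + 1 = N from hm.symm] at hlim
  obtain ⟨x, hx1, hx2⟩ := EReal.exists_between_coe_real ha
  obtain ⟨y, hy⟩ := Filter.eventually_atTop.1 (hlim.eventually
    (Metric.closedBall_mem_nhds (b N) (show 0 < ‖a N‖ / 2 by positivity)))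
  refine ⟨N, Nat.pos_of_ne_zero hN0, hN, max x y,
    hx1.trans_le (EReal.coe_le_coe_iff.2 (le_max_left x y)), fun σ hσ u ↦ ?_⟩
  set s : ℂ := σ + u * I
  have hsre : s.re = σ := by simp [s]
  have hsum : LSeriesSummable a s := LSeriesSummable_of_abscissaOfAbsConv_lt_re
    (hx1.trans_le (EReal.coe_le_coe_iff.2 (by rw [hsre]; exact (le_max_left x y).trans hσ)))
  set v : ℕ → ℂ := fun n ↦ (N : ℂ) ^ s * LSeries.term a s n
  have hNpos : 0 < (N : ℝ) := by positivity
  have hv : Summable v := hsum.mul_left _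
  have hvN : v N = a N := by
    simp only [v, LSeries.term_of_ne_zero hN0]
    rw [mul_div_cancel₀]
    simp [cpow_eq_zero_iff, hN0]
  have hvnorm (n : ℕ) : ((‖v n‖ : ℝ) : ℂ) = (N : ℂ) ^ (σ : ℂ) * LSeries.term b σ n := by
    simp only [v, norm_mul, LSeries.norm_term_eq, hsre, b]
    rw [← ofReal_natCast, norm_cpow_eq_rpow_re_of_pos hNpos, hsre, ofReal_mul,
      ofReal_cpow hNpos.le]
    congr 1
    rcases eq_or_ne n 0 with rfl | hn
    · simp
    · rw [if_neg hn, LSeries.term_of_ne_zero hn, ofReal_div, ofReal_cpow n.cast_nonneg]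
      rfl
  have e1 : (N : ℂ) ^ s * LSeries a s - a N = ∑' n, if n = N then 0 else v n := by
    rw [LSeries, ← tsum_mul_left, ← hvN]
    change ∑' n, v n - v N = _
    rw [hv.tsum_eq_add_tsum_ite N, add_sub_cancel_left]
  have e2 : (N : ℂ) ^ (σ : ℂ) * LSeries b σ - b N =
      ((∑' n, if n = N then 0 else ‖v n‖ : ℝ) : ℂ) := by
    rw [LSeries, ← tsum_mul_left]
    simp_rw [← hvnorm]
    rw [← ofReal_tsum, hv.norm.tsum_eq_add_tsum_ite N, hvN]
    push_cast
    rw [add_sub_cancel_left]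
  have e3 := hy σ ((le_max_right x y).trans hσ)
  rw [dist_eq_norm, e2, norm_real] at e3
  rw [e1]
  have hv' : Summable fun n ↦ ‖if n = N then 0 else v n‖ := by
    refine hv.norm.of_nonneg_of_le (fun n ↦ norm_nonneg _) fun n ↦ ?_
    split_ifs <;> simp
  refine (norm_tsum_le_tsum_norm hv').trans (le_trans (le_of_eq ?_) ((le_abs_self _).trans e3))
  refine tsum_congr fun n ↦ ?_
  split_ifs <;> simp

end CriticalLine

/-! ### The Hardy–Littlewood argument: zero-free windows are rare -/

section HardyLittlewood

open MeasureTheory Complex Set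

/-- Cauchy–Schwarz, read off from the nonnegativity of the variance of f on S. -/
theorem sq_setIntegral_le {f : ℝ → ℝ} (hf : Continuous f) {S : Set ℝ} {a b : ℝ}
    (hSab : S ⊆ Icc a b) :
    (∫ t in S, f t) ^ 2 ≤ volume.real S * ∫ t in S, f t ^ 2 := by
  have hi (g : ℝ → ℝ) (hg : Continuous g) : IntegrableOn g S :=
    hg.continuousOn.integrableOn_Icc.mono_set hSab
  rcases (measureReal_nonneg (μ := volume) (s := S)).eq_or_lt with h0 | h0
  · have hfin : volume S ≠ ⊤ := ((measure_mono hSab).trans_lt measure_Icc_lt_top).ne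
    have hS0 : volume S = 0 := by
      rcases (ENNReal.toReal_eq_zero_iff _).1 h0.symm with h | h
      exacts [h, absurd h hfin]
    rw [← h0, Measure.restrict_eq_zero.2 hS0]
    simp
  set μ := volume.real S
  set J := ∫ t in S, f t
  have h1 : 0 ≤ ∫ t in S, (f t - J / μ) ^ 2 := integral_nonneg fun t ↦ sq_nonneg _
  have h2 : ∫ t in S, (f t - J / μ) ^ 2 = (∫ t in S, f t ^ 2) - J ^ 2 / μ := by
    have h3 (t : ℝ) : (f t - J / μ) ^ 2 = f t ^ 2 - 2 * (J / μ) * f t + (J / μ) ^ 2 := by ring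
    simp_rw [h3]
    rw [integral_add (hi _ (by fun_prop)) (hi _ (by fun_prop)), integral_sub (hi _ (by fun_prop))
      (hi _ (by fun_prop)), integral_const_mul, setIntegral_const]
    change (_ - 2 * (J / μ) * J) + μ • (J / μ) ^ 2 = _
    rw [smul_eq_mul]
    field_simp
    ring
  rw [h2, sub_nonneg, div_le_iff₀ h0] at h1
  linarith

/-- After exchanging the integrals, Cauchy–Schwarz and the mean square at abscissa x give
√(C·vol(S)·T) (x - κ)^{-1/2}, whose singularity at κ is integrable. The bound does not grow with the
height shift δ. -/
theorem setIntegral_horizontal_le {κ : ℝ} {L : ℂ → ℂ} (hL : Differentiable ℂ L) {B : ℝ}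
    (hB : 0 < B) (hA : ∃ C : ℝ, 0 ≤ C ∧ ∀ T : ℝ, 1 ≤ T → ∀ β : ℝ, 0 < β → β ≤ B →
      ∫ u in Icc T (3 * T), ‖L ((κ + β : ℝ) + u * I)‖ ^ 2 ≤ C * T / β) :
    ∃ C : ℝ, 0 ≤ C ∧ ∀ T : ℝ, 1 ≤ T → ∀ δ : ℝ, 0 ≤ δ → δ ≤ T → ∀ S : Set ℝ,
      MeasurableSet S → S ⊆ Icc T (2 * T) →
      ∫ t in S, (∫ x in κ..κ + B, ‖L (x + (t + δ : ℝ) * I)‖) ≤ C * √(volume.real S * T) := by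
  obtain ⟨C, hC0, hC⟩ := hA
  refine ⟨√C * (2 * √B), by positivity, fun T hT δ hδ hδT S hSm hS ↦ ?_⟩
  have hT0 : 0 < T := by linarith
  have hLc := hL.continuous
  set μ := volume.real S
  have hμ : 0 ≤ μ := measureReal_nonneg
  have hprod : Integrable (Function.uncurry fun x t : ℝ ↦ ‖L (x + (t + δ : ℝ) * I)‖)
      ((volume.restrict (uIoc κ (κ + B))).prod (volume.restrict S)) := by
    rw [Measure.prod_restrict]
    have : IntegrableOn (Function.uncurry fun x t : ℝ ↦ ‖L (x + (t + δ : ℝ) * I)‖)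
        (uIcc κ (κ + B) ×ˢ Icc T (2 * T)) := by
      refine ContinuousOn.integrableOn_compact (isCompact_uIcc.prod isCompact_Icc) ?_
      unfold Function.uncurry
      fun_prop
    exact this.mono_set (prod_mono uIoc_subset_uIcc hS)
  have hswap : ∫ t in S, (∫ x in κ..κ + B, ‖L (x + (t + δ : ℝ) * I)‖) =
      ∫ x in κ..κ + B, (∫ t in S, ‖L (x + (t + δ : ℝ) * I)‖) := (intervalIntegral_integral_swap hprod).symm
  have hpt : ∀ x ∈ Ioo κ (κ + B), ∫ t in S, ‖L (x + (t + δ : ℝ) * I)‖ ≤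
      √C * √(μ * T) * (x - κ) ^ (-(1 / 2) : ℝ) := fun x hx ↦ by
    have hx0 : 0 < x - κ := by linarith [hx.1]
    have h1 := sq_setIntegral_le (f := fun t ↦ ‖L (x + (t + δ : ℝ) * I)‖) (by fun_prop) hS
    have h2 : ∫ t in S, ‖L (x + (t + δ : ℝ) * I)‖ ^ 2 ≤ C * T / (x - κ) := by
      have h3 := hC T hT (x - κ) hx0 (by linarith [hx.2])
      rw [add_sub_cancel] at h3
      refine le_trans ?_ h3
      have hci (a b : ℝ) : IntegrableOn (fun t : ℝ ↦ ‖L (x + (t + δ : ℝ) * I)‖ ^ 2) (Icc a b) :=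
        (Continuous.continuousOn (by fun_prop)).integrableOn_Icc
      have hci2 (a b : ℝ) : IntegrableOn (fun t : ℝ ↦ ‖L (x + t * I)‖ ^ 2) (Icc a b) :=
        (Continuous.continuousOn (by fun_prop)).integrableOn_Icc
      calc _ ≤ ∫ t in Icc T (2 * T), ‖L (x + (t + δ : ℝ) * I)‖ ^ 2 :=
            setIntegral_mono_set (hci _ _) (.of_forall fun t ↦ sq_nonneg _) hS.eventuallyLE
        _ = ∫ t in Icc (T + δ) (2 * T + δ), ‖L (x + t * I)‖ ^ 2 := by
            rw [integral_Icc_eq_integral_Ioc, integral_Icc_eq_integral_Ioc,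
              ← intervalIntegral.integral_of_le (by linarith),
              ← intervalIntegral.integral_of_le (by linarith),
              intervalIntegral.integral_comp_add_right (fun t : ℝ ↦ ‖L (x + t * I)‖ ^ 2)]
        _ ≤ _ := setIntegral_mono_set (hci2 _ _) (.of_forall fun t ↦ sq_nonneg _)
            (Icc_subset_Icc (by linarith) (by linarith)).eventuallyLE
    refine abs_le_of_sq_le_sq' ?_ (by positivity) |>.2
    refine h1.trans ((mul_le_mul_of_nonneg_left h2 hμ).trans (le_of_eq ?_))
    rw [mul_pow, mul_pow, Real.sq_sqrt hC0, Real.sq_sqrt (by positivity),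
      ← Real.rpow_mul_natCast hx0.le]
    norm_num [Real.rpow_neg_one]
    ring
  have hint : IntervalIntegrable (fun x : ℝ ↦ (x - κ) ^ (-(1 / 2) : ℝ)) volume κ (κ + B) := by
    have := (intervalIntegral.intervalIntegrable_rpow' (a := 0) (b := B) (r := -(1 / 2))
      (by norm_num)).comp_sub_right κ
    simpa [add_comm] using this
  have hval : ∫ x in κ..κ + B, (x - κ) ^ (-(1 / 2) : ℝ) = 2 * √B := by
    rw [intervalIntegral.integral_comp_sub_right (fun x ↦ x ^ (-(1 / 2) : ℝ)), sub_self,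
      add_sub_cancel_left, integral_rpow (Or.inl (by norm_num)), Real.sqrt_eq_rpow]
    norm_num
    ring
  rw [hswap]
  calc _ ≤ ∫ x in κ..κ + B, √C * √(μ * T) * (x - κ) ^ (-(1 / 2) : ℝ) := by
        refine intervalIntegral.integral_mono_on_of_le_Ioo (by linarith) ?_ (hint.const_mul _) hpt
        exact intervalIntegrable_iff.2 hprod.integral_prod_left
    _ = _ := by
      rw [intervalIntegral.integral_const_mul, hval]
      ring

/-- Comparison of the integral of `|L|` over a short piece of the line `Re s = κ` with its
value in the region where the Dirichlet series is dominated by its leading term. -/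
theorem exists_le_integral_norm_add {κ : ℝ} {L : ℂ → ℂ} (hL : Differentiable ℂ L) {N : ℕ}
    (hN : 0 < N) {b : ℂ} (hb : b ≠ 0) {σ₀ : ℝ} (h₀ : ∀ σ : ℝ, σ₀ ≤ σ → ∀ u : ℝ,
      ‖(N : ℂ) ^ ((σ : ℂ) + u * I) * L (σ + u * I) - b‖ ≤ ‖b‖ / 2) :
    ∃ B c : ℝ, 0 < B ∧ 0 < c ∧ ∀ t h : ℝ, 0 ≤ h → c * h ≤ (∫ u in t..t + h, ‖L (κ + u * I)‖) +
      (∫ x in κ..κ + B, ‖L (x + t * I)‖) + ∫ x in κ..κ + B, ‖L (x + (t + h : ℝ) * I)‖ := by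
  set B := max 1 (σ₀ - κ)
  have hB : 0 < B := lt_max_of_lt_left one_pos
  have hN1 : (1 : ℝ) ≤ N := by exact_mod_cast hN
  have hNC : (N : ℂ) ≠ 0 := Nat.cast_ne_zero.2 hN.ne'
  set K := (N : ℝ) ^ (κ + B)
  have hK : 0 < K := by positivity
  have hLc := hL.continuous
  refine ⟨B, ‖b‖ / 2 / K, hB, by positivity, fun t h hh ↦ ?_⟩
  -- Multiplication by N^s turns the leading term into the constant b, so the integral along the
  -- right edge of the rectangle is within h‖b‖/2 of hb. The other three edges must compensate.
  set M : ℂ → ℂ := fun s ↦ (N : ℂ) ^ s * L s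
  have hM : Differentiable ℂ M := (differentiable_id.const_cpow (Or.inl hNC)).mul hL
  have hMc := hM.continuous
  have hMle {x : ℝ} (hx : x ≤ κ + B) (u : ℝ) : ‖M (x + u * I)‖ ≤ K * ‖L (x + u * I)‖ := by
    simp only [M, norm_mul]
    rw [← ofReal_natCast, norm_cpow_eq_rpow_re_of_pos (by positivity)]
    gcongr
    exact Real.rpow_le_rpow_of_exponent_le hN1 (by simpa using hx)
  have hrect := integral_boundary_rect_eq_zero_of_differentiableOn M (κ + t * I)
    ((κ + B : ℝ) + (t + h : ℝ) * I) hM.differentiableOn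
  simp only [add_re, add_im, ofReal_re, ofReal_im, mul_re, mul_im, I_re, I_im, mul_zero, mul_one,
    add_zero, zero_add, sub_self] at hrect
  set P1 := ∫ x in κ..κ + B, M (x + t * I)
  set P2 := ∫ x in κ..κ + B, M (x + (t + h : ℝ) * I)
  set P3 := ∫ y in t..t + h, M ((κ + B : ℝ) + y * I)
  set P4 := ∫ y in t..t + h, M (κ + y * I)
  have hP3 : ‖P3‖ ≤ ‖P4‖ + ‖P1‖ + ‖P2‖ := by
    have : I • P3 = I • P4 - P1 + P2 := by linear_combination hrect
    have h2 := congrArg norm this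
    rw [norm_smul, norm_I, one_mul] at h2
    rw [h2]
    refine (norm_add_le _ _).trans ?_
    gcongr
    refine (norm_sub_le _ _).trans ?_
    rw [norm_smul, norm_I, one_mul]
  have hb1 : ‖b‖ / 2 * h ≤ ‖P3‖ := by
    have h1 : P3 - h * b = ∫ y in t..t + h, (M ((κ + B : ℝ) + y * I) - b) := by
      rw [intervalIntegral.integral_sub (Continuous.intervalIntegrable (by fun_prop) _ _)
        (by simp), intervalIntegral.integral_const, add_sub_cancel_left]
      simp [P3]
    have h2 : ‖P3 - h * b‖ ≤ ‖b‖ / 2 * h := by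
      rw [h1]
      refine (intervalIntegral.norm_integral_le_of_norm_le_const fun y _ ↦
        h₀ (κ + B) (by linarith [le_max_right 1 (σ₀ - κ)]) y).trans (le_of_eq ?_)
      rw [add_sub_cancel_left, abs_of_nonneg hh]
    have h3 : ‖(h : ℂ) * b‖ = h * ‖b‖ := by rw [norm_mul, norm_real, Real.norm_of_nonneg hh]
    have h4 := norm_sub_norm_le ((h : ℂ) * b) P3
    rw [norm_sub_rev] at h4
    linarith
  have hP4 : ‖P4‖ ≤ K * ∫ u in t..t + h, ‖L (κ + u * I)‖ := by
    rw [← intervalIntegral.integral_const_mul]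
    exact intervalIntegral.norm_integral_le_of_norm_le (by linarith)
      (.of_forall fun u _ ↦ hMle (by linarith) u)
      (Continuous.intervalIntegrable (by fun_prop) _ _)
  have hP12 (v : ℝ) : ‖∫ x in κ..κ + B, M (x + v * I)‖ ≤
      K * ∫ x in κ..κ + B, ‖L (x + v * I)‖ := by
    rw [← intervalIntegral.integral_const_mul]
    exact intervalIntegral.norm_integral_le_of_norm_le (by linarith)
      (.of_forall fun x hx ↦ hMle hx.2 v)
      (Continuous.intervalIntegrable (by fun_prop) _ _)
  have h5 := hP12 t
  have h6 := hP12 (t + h)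
  rw [div_mul_eq_mul_div, div_le_iff₀ hK]
  simp only [P1, P2] at hP3
  linarith

theorem abs_integral_eq_of_forall_ne_zero {Z : ℝ → ℝ} (hZ : Continuous Z) {a b : ℝ} (hab : a < b)
    (h : ∀ u ∈ Ioo a b, Z u ≠ 0) : |∫ u in a..b, Z u| = ∫ u in a..b, |Z u| := by
  have hsign : (∀ u ∈ Ioo a b, 0 ≤ Z u) ∨ ∀ u ∈ Ioo a b, Z u ≤ 0 := by
    by_contra! hcon
    obtain ⟨⟨u, hu, hu0⟩, v, hv, hv0⟩ := hcon
    obtain ⟨w, hw, hw0⟩ := isPreconnected_Ioo.intermediate_value hu hv hZ.continuousOn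
      ⟨hu0.le, hv0.le⟩
    exact h w hw hw0
  have hcl {s : Set ℝ} (hs : IsClosed s) (h : Ioo a b ⊆ s) : Icc a b ⊆ s := by
    rw [← closure_Ioo hab.ne]
    exact closure_minimal h hs
  rcases hsign with hs | hs
  · have h1 : ∀ u ∈ Icc a b, 0 ≤ Z u := hcl (isClosed_le continuous_const hZ) hs
    rw [abs_of_nonneg (intervalIntegral.integral_nonneg hab.le h1)]
    refine intervalIntegral.integral_congr fun u hu ↦ ?_
    rw [uIcc_of_le hab.le] at hu
    exact (abs_of_nonneg (h1 u hu)).symm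
  · have h1 : ∀ u ∈ Icc a b, Z u ≤ 0 := hcl (isClosed_le hZ continuous_const) hs
    rw [abs_of_nonpos, ← intervalIntegral.integral_neg]
    · refine intervalIntegral.integral_congr fun u hu ↦ ?_
      rw [uIcc_of_le hab.le] at hu
      exact (abs_of_nonpos (h1 u hu)).symm
    · have := intervalIntegral.integral_nonneg hab.le (f := fun u ↦ -Z u) (μ := volume)
        fun u hu ↦ neg_nonneg.2 (h1 u hu)
      rw [intervalIntegral.integral_neg] at this
      linarith

/-- The set of points which begin a zero-free interval of length `h` has small measure. -/
theorem volume_zeroFree_le {k : ℝ} {L : ℂ → ℂ} (hL : Differentiable ℂ L)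
    (hA : ∀ B : ℝ, ∃ C : ℝ, 0 ≤ C ∧ ∀ T : ℝ, 1 ≤ T → ∀ β : ℝ, 0 < β → β ≤ B →
      ∫ u in Icc T (3 * T), ‖L ((k / 2 + β : ℝ) + u * I)‖ ^ 2 ≤ C * T / β)
    (hZ : ∃ c C : ℝ, 0 < c ∧ 0 ≤ C ∧ ∀ T : ℝ, 1 ≤ T → ∃ Z : ℝ → ℝ, Continuous Z ∧
      (∀ u ∈ Icc T (3 * T), c * T ^ ((k - 1) / 2) * ‖L ((k / 2 : ℝ) + u * I)‖ ≤ |Z u|) ∧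
      (∀ u ∈ Icc T (3 * T), Z u = 0 → L ((k / 2 : ℝ) + u * I) = 0) ∧
      ∀ h : ℝ, 0 < h → ∫ t in Icc T (2 * T), (∫ u in t..t + h, Z u) ^ 2 ≤ C * T ^ k * h)
    (hD : ∃ N : ℕ, 0 < N ∧ ∃ b : ℂ, b ≠ 0 ∧ ∃ σ₀ : ℝ, ∀ σ : ℝ, σ₀ ≤ σ → ∀ u : ℝ,
      ‖(N : ℂ) ^ ((σ : ℂ) + u * I) * L (σ + u * I) - b‖ ≤ ‖b‖ / 2) :
    ∃ h : ℝ, 1 ≤ h ∧ ∀ T : ℝ, h ≤ T → ∀ S : Set ℝ, MeasurableSet S → S ⊆ Icc T (2 * T) →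
      (∀ t ∈ S, ∀ u ∈ Ioo t (t + h), L ((k / 2 : ℝ) + u * I) ≠ 0) → volume.real S ≤ T / 2 := by
  obtain ⟨N, hN, b, hb, σ₀, h₀⟩ := hD
  obtain ⟨B, c₁, hB, hc₁, hcontour⟩ := exists_le_integral_norm_add (κ := k / 2) hL hN hb h₀
  obtain ⟨C₂, hC₂, hhor⟩ := setIntegral_horizontal_le hL hB (hA B)
  obtain ⟨c, C, hc, hC, hZ⟩ := hZ
  set A := √C / c + 2 * C₂
  have hA0 : 0 ≤ A := by positivity
  -- The final inequality is c₁²hμ ≤ A²T, so this h forces μ ≤ T/2.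
  set h := max 1 (2 * (A / c₁) ^ 2)
  have hh1 : 1 ≤ h := le_max_left _ _
  have hh0 : 0 < h := by linarith
  refine ⟨h, hh1, fun T hT S hSm hS hzf ↦ ?_⟩
  have hT1 : 1 ≤ T := hh1.trans hT
  have hT0 : 0 < T := by linarith
  obtain ⟨Z, hZc, hZlow, hZzero, hZsq⟩ := hZ T hT1
  set μ := volume.real S
  have hμ : 0 ≤ μ := measureReal_nonneg
  have hLc := hL.continuous
  set q := c * T ^ ((k - 1) / 2)
  have hq : 0 < q := by positivity
  set W : ℝ → ℝ := fun t ↦ ∫ u in t..t + h, Z u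
  have hW : Continuous W := continuous_intervalIntegral_add hZc h
  set Ξ : ℝ → ℝ → ℝ := fun δ t ↦ ∫ x in k / 2..k / 2 + B, ‖L (x + (t + δ : ℝ) * I)‖
  have hΞ (δ : ℝ) : Continuous (Ξ δ) :=
    intervalIntegral.continuous_parametric_intervalIntegral_of_continuous'
      (f := fun t x : ℝ ↦ ‖L (x + (t + δ : ℝ) * I)‖) (by fun_prop) _ _
  have hi {g : ℝ → ℝ} (hg : Continuous g) : IntegrableOn g S :=
    hg.continuousOn.integrableOn_Icc.mono_set hS
  -- Absence of zeros is used only here: Z keeps its sign on the window, so ∫|L| is controlled by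
  -- |∫Z|. The condition h ≤ T keeps the window inside [T, 3T].
  have hpt : ∀ t ∈ S, c₁ * h ≤ q⁻¹ * |W t| + Ξ 0 t + Ξ h t := fun t ht ↦ by
    have ht' := hS ht
    have hsub : Icc t (t + h) ⊆ Icc T (3 * T) :=
      Icc_subset_Icc ht'.1 (by linarith [ht'.2])
    have h1 := hcontour t h hh0.le
    have h2 : ∫ u in t..t + h, ‖L ((k / 2 : ℝ) + u * I)‖ ≤ q⁻¹ * |W t| := by
      rw [abs_integral_eq_of_forall_ne_zero hZc (by linarith) fun u hu h0 ↦
        hzf t ht u hu (hZzero u (hsub (Ioo_subset_Icc_self hu)) h0), ← div_eq_inv_mul,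
        le_div_iff₀ hq, mul_comm, ← intervalIntegral.integral_const_mul]
      exact intervalIntegral.integral_mono_on (by linarith)
        (Continuous.intervalIntegrable (by fun_prop) _ _)
        (hZc.abs.intervalIntegrable _ _) fun u hu ↦ hZlow u (hsub hu)
    simp only [Ξ, add_zero]
    linarith
  have hWint : ∫ t in S, |W t| ≤ √(C * T ^ k * h) * √μ := by
    rw [← Real.sqrt_mul (by positivity)]
    refine Real.le_sqrt_of_sq_le ?_
    refine (sq_setIntegral_le hW.abs hS).trans ?_
    rw [mul_comm]
    refine mul_le_mul_of_nonneg_right ?_ hμ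
    simp_rw [sq_abs]
    exact (setIntegral_mono_set ((hW.pow 2).continuousOn.integrableOn_Icc)
      (.of_forall fun t ↦ sq_nonneg _) hS.eventuallyLE).trans (hZsq h hh0)
  have hmain : c₁ * h * μ ≤ q⁻¹ * (√(C * T ^ k * h) * √μ) + C₂ * √(μ * T) + C₂ * √(μ * T) := by
    calc c₁ * h * μ = ∫ t in S, c₁ * h := by
          rw [setIntegral_const, smul_eq_mul]; ring
      _ ≤ ∫ t in S, (q⁻¹ * |W t| + Ξ 0 t + Ξ h t) :=
          setIntegral_mono_on (hi continuous_const)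
            (hi (((continuous_const.mul hW.abs).add (hΞ 0)).add (hΞ h))) hSm hpt
      _ = q⁻¹ * (∫ t in S, |W t|) + (∫ t in S, Ξ 0 t) + ∫ t in S, Ξ h t := by
          have i1 : IntegrableOn (fun t ↦ q⁻¹ * |W t|) S := hi (continuous_const.mul hW.abs)
          have i2 : IntegrableOn (fun t ↦ q⁻¹ * |W t| + Ξ 0 t) S := i1.add (hi (hΞ 0))
          rw [integral_add i2 (hi (hΞ h)), integral_add i1 (hi (hΞ 0)), integral_const_mul]
      _ ≤ _ := by
          gcongr
          · exact hhor T hT1 0 le_rfl hT0.le S hSm hS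
          · exact hhor T hT1 h hh0.le hT S hSm hS
  have hqT : q⁻¹ * √(C * T ^ k * h) = √C / c * √T * √h := by
    have h1 : √(T ^ k) = T ^ (k / 2) := by
      rw [Real.sqrt_eq_rpow, ← Real.rpow_mul hT0.le]; ring_nf
    have h2 : T ^ (k / 2) = T ^ ((k - 1) / 2) * √T := by
      rw [Real.sqrt_eq_rpow, ← Real.rpow_add hT0]; ring_nf
    rw [Real.sqrt_mul (by positivity), Real.sqrt_mul hC, h1, h2]
    simp only [q]
    have : 0 < T ^ ((k - 1) / 2) := by positivity
    field_simp
  have hsh : 1 ≤ √h := Real.one_le_sqrt.2 hh1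
  -- The horizontal terms have no factor √h; they are absorbed using √h ≥ 1.
  have hmain2 : c₁ * h * μ ≤ A * √h * √T * √μ := by
    rw [← mul_assoc, hqT, Real.sqrt_mul hμ] at hmain
    have h3 : C₂ * (√μ * √T) ≤ C₂ * (√μ * √T) * √h :=
      le_mul_of_one_le_right (by positivity) hsh
    simp only [A]
    linarith
  rcases hμ.eq_or_lt with h0 | hμ0
  · rw [← h0]; positivity
  have hsμ : 0 < √μ := Real.sqrt_pos.2 hμ0
  have hs2 : 0 < √h := by linarith
  have hmain3 : c₁ * √h * √μ ≤ A * √T := by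
    have e1 : c₁ * h * μ = (c₁ * √h * √μ) * (√h * √μ) := by
      nth_rewrite 1 [← Real.mul_self_sqrt hh0.le, ← Real.mul_self_sqrt hμ]
      ring
    have e2 : A * √h * √T * √μ = (A * √T) * (√h * √μ) := by ring
    rw [e1, e2] at hmain2
    exact le_of_mul_le_mul_right hmain2 (by positivity)
  have hsq : c₁ ^ 2 * h * μ ≤ A ^ 2 * T := by
    have := pow_le_pow_left₀ (by positivity) hmain3 2
    rwa [mul_pow, mul_pow, mul_pow, Real.sq_sqrt hh0.le, Real.sq_sqrt hμ, Real.sq_sqrt hT0.le]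
      at this
  have hhge : 2 * A ^ 2 ≤ c₁ ^ 2 * h := by
    have h4 : 2 * (A / c₁) ^ 2 ≤ h := le_max_right _ _
    rw [div_pow, ← mul_div_assoc, div_le_iff₀ (by positivity)] at h4
    linarith
  rcases hA0.eq_or_lt with hA1 | hA1
  · rw [← hA1] at hsq
    have : 0 < c₁ ^ 2 * h * μ := by positivity
    nlinarith
  · have h5 : 2 * A ^ 2 * μ ≤ A ^ 2 * T := (mul_le_mul_of_nonneg_right hhge hμ).trans hsq
    have h6 : A ^ 2 * (2 * μ) ≤ A ^ 2 * T := by linarith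
    have := le_of_mul_le_mul_left h6 (by positivity)
    linarith

/-- A point t of [T, 2T] outside every (u - h, u), with u in the counted set, begins a window free
of `P`. Such t have measure at most T/2, so the intervals cover at least T/2 and their number is at
least T/(2h). -/
theorem exists_lt_liminf_of_zeroFree {P : ℝ → Prop} {h : ℝ} (hh : 1 ≤ h)
    (hS : ∀ T : ℝ, h ≤ T → ∀ S : Set ℝ, MeasurableSet S → S ⊆ Icc T (2 * T) →
      (∀ t ∈ S, ∀ u ∈ Ioo t (t + h), ¬ P u) → volume.real S ≤ T / 2) :
    ∃ d : ℝ, 0 < d ∧ ENNReal.ofReal d < Filter.liminf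
      (fun T : ℝ ↦ (({t : ℝ | 0 ≤ t ∧ t ≤ T ∧ P t}.encard : ℕ∞) : ENNReal) / ENNReal.ofReal T)
      Filter.atTop := by
  have hh0 : 0 < h := by linarith
  -- With X = 3T the count is at least X/(6h); halving the constant makes the inequality strict.
  refine ⟨1 / (12 * h), by positivity, ?_⟩
  have hlt : ENNReal.ofReal (1 / (12 * h)) < ENNReal.ofReal (1 / (6 * h)) := by
    rw [ENNReal.ofReal_lt_ofReal_iff (by positivity)]
    gcongr
    norm_num
  refine hlt.trans_le (Filter.le_liminf_of_le (by isBoundedDefault) ?_)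
  filter_upwards [Filter.eventually_ge_atTop (3 * h)] with X hX
  set T := X / 3
  have hXT : X = 3 * T := by simp only [T]; ring
  have hT : h ≤ T := by linarith
  have hT0 : 0 < T := by linarith
  set Q := {t : ℝ | 0 ≤ t ∧ t ≤ X ∧ P t}
  rw [ENNReal.le_div_iff_mul_le (Or.inl (by simp; linarith)) (Or.inl ENNReal.ofReal_ne_top),
    ← ENNReal.ofReal_mul (by positivity)]
  rcases Q.finite_or_infinite with hfin | hinf
  swap
  · rw [hinf.encard_eq]
    simp
  set U : Set ℝ := ⋃ u ∈ hfin.toFinset, Ioo (u - h) u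
  have hUm : MeasurableSet U := Finset.measurableSet_biUnion _ fun u _ ↦ measurableSet_Ioo
  have h1 := hS T hT (Icc T (2 * T) \ U) (measurableSet_Icc.diff hUm) sdiff_subset
    fun t ht u hu hP ↦ ht.2 (by
      simp only [U, mem_iUnion, Finite.mem_toFinset]
      refine ⟨u, ⟨?_, ?_, hP⟩, ?_, hu.1⟩
      · linarith [ht.1.1, hu.1]
      · linarith [ht.1.2, hu.2]
      · linarith [hu.2])
  have hUvol : volume U ≤ hfin.toFinset.card * ENNReal.ofReal h := by
    refine (measure_biUnion_finset_le _ _).trans (le_of_eq ?_)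
    simp
  have hUfin : volume U ≠ ⊤ :=
    (hUvol.trans_lt (ENNReal.mul_lt_top (ENNReal.natCast_lt_top _) ENNReal.ofReal_lt_top)).ne
  have hUreal : volume.real U ≤ hfin.toFinset.card * h := by
    have := ENNReal.toReal_mono (ENNReal.mul_ne_top (ENNReal.natCast_ne_top _)
      ENNReal.ofReal_ne_top) hUvol
    rwa [ENNReal.toReal_mul, ENNReal.toReal_natCast, ENNReal.toReal_ofReal hh0.le] at this
  have h2 : volume.real (Icc T (2 * T)) ≤ volume.real (Icc T (2 * T) \ U) + volume.real U := by
    refine (measureReal_mono (s₂ := (Icc T (2 * T) \ U) ∪ U) (by simp) ?_).trans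
      (measureReal_union_le _ _)
    rw [sdiff_union_self]
    exact (measure_union_lt_top measure_Icc_lt_top hUfin.lt_top).ne
  rw [Real.volume_real_Icc_of_le (by linarith)] at h2
  have h3 : T / 2 ≤ hfin.toFinset.card * h := by linarith
  rw [hfin.encard_eq_coe_toFinset_card, ENat.toENNReal_coe, ← ENNReal.ofReal_natCast]
  refine ENNReal.ofReal_le_ofReal ?_
  rw [hXT, one_div, inv_mul_le_iff₀ (by positivity)]
  linarith

end HardyLittlewood

/-! ### Cusp forms: growth, symmetry and the twisted Dirichlet series -/

section CuspFormLFunction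

open Complex Set Filter Topology Matrix
open UpperHalfPlane hiding I

/-- A rational number with `p ^ 2 ≡ 1 (mod q)` that is `Γ₀(N)`-equivalent to `∞` has denominator
divisible by `N`. -/
theorem IsGamma0EquivInfty.dvd {N : ℕ} {p q : ℤ} (hq : q ≠ 0)
    (h : IsGamma0EquivInfty N ((p : ℚ) / (q : ℚ))) (hpq : p ^ 2 ≡ 1 [ZMOD q]) : (N : ℤ) ∣ q := by
  obtain ⟨γ, hγ, h⟩ := h
  rw [OnePoint.smul_infty_eq_ite] at h
  have hN : (N : ℤ) ∣ γ 1 0 := (ZMod.intCast_zmod_eq_zero_iff_dvd _ _).1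
    (CongruenceSubgroup.Gamma0_mem.1 hγ)
  split_ifs at h with h0
  · exact absurd h (OnePoint.infty_ne_coe _)
  have hc : (γ 1 0 : ℚ) ≠ 0 := by simpa using! h0
  have h' : (γ 0 0 : ℚ) / γ 1 0 = p / q := by simpa using OnePoint.coe_injective h
  have hq' : (q : ℚ) ≠ 0 := by exact_mod_cast hq
  rw [div_eq_div_iff hc hq'] at h'
  have hac : γ 0 0 * q = p * γ 1 0 := by exact_mod_cast h'
  obtain ⟨m, hm⟩ := hpq.dvd
  -- Both p/q and the first column of γ are in lowest terms, so q and the lower left entry of γ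
  -- divide each other, and N divides the latter.
  have hcop : IsCoprime q p := ⟨m, p, by linarith⟩
  have hqc : q ∣ γ 1 0 := hcop.dvd_of_dvd_mul_left ⟨γ 0 0, by linarith⟩
  have hdet := γ.det_coe
  rw [det_fin_two] at hdet
  have hcop' : IsCoprime (γ 1 0) (γ 0 0) := ⟨-γ 0 1, γ 1 1, by linarith⟩
  have hcq : γ 1 0 ∣ q := hcop'.dvd_of_dvd_mul_left ⟨p, by linarith⟩
  exact hN.trans hcq

section CuspForm

variable {N : ℕ} {k : ℤ} (f : CuspForm (Gamma0GL N) k)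

theorem one_mem_strictPeriods_Gamma0GL (N : ℕ) : (1 : ℝ) ∈ (Gamma0GL N).strictPeriods := by
  rw [CongruenceSubgroup.strictPeriods_Gamma0]
  exact AddSubgroup.mem_zmultiples 1

theorem isArithmetic_Gamma0GL (hN : 0 < N) : (Gamma0GL N).IsArithmetic := by
  have : NeZero N := ⟨hN.ne'⟩
  infer_instance

theorem hasSum_cuspFourierCoeff (τ : ℍ) :
    HasSum (fun n : ℕ ↦ cuspFourierCoeff f n * exp (2 * Real.pi * I * τ * n)) (f τ) := by
  have h1 := one_mem_strictPeriods_Gamma0GL N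
  have : Fact (IsCusp OnePoint.infty (Gamma0GL N)) :=
    ⟨(Gamma0GL N).isCusp_of_mem_strictPeriods one_pos h1⟩
  have := hasSum_qExpansion one_pos (SlashInvariantFormClass.periodic_comp_ofComplex f h1)
    (CuspFormClass.holo f) (ModularFormClass.bdd_at_infty f) τ
  refine this.congr_fun fun n ↦ ?_
  rw [Function.Periodic.qParam, ← exp_nat_mul, smul_eq_mul, cuspFourierCoeff]
  congr 2
  push_cast
  ring

theorem twistedCoeff_zero (x : ℚ) : twistedCoeff f x 0 = 0 := by
  rw [twistedCoeff, cuspFourierCoeff,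
    CuspFormClass.qExpansion_coeff_zero f one_pos (one_mem_strictPeriods_Gamma0GL N), zero_mul]

theorem norm_twistedCoeff (x : ℚ) (n : ℕ) : ‖twistedCoeff f x n‖ = ‖cuspFourierCoeff f n‖ := by
  rw [twistedCoeff, norm_mul, show (2 * Real.pi * I * x * n : ℂ) = (2 * Real.pi * x * n : ℝ) * I by
    push_cast; ring, norm_exp_ofReal_mul_I, mul_one]

theorem abscissaOfAbsConv_twistedCoeff_lt_top (hN : 0 < N) (x : ℚ) :
    LSeries.abscissaOfAbsConv (twistedCoeff f x) < ⊤ := by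
  have := isArithmetic_Gamma0GL hN
  have h := CuspFormClass.qExpansion_isBigO f
  rw [CongruenceSubgroup.strictWidthInfty_Gamma0] at h
  have h' : twistedCoeff f x =O[atTop] fun n : ℕ ↦ (n : ℝ) ^ ((k : ℝ) / 2) :=
    (Asymptotics.isBigO_of_le _ fun n ↦ (norm_twistedCoeff f x n).le).trans h
  refine (LSeries.abscissaOfAbsConv_le_of_isBigO_rpow h').trans_lt ?_
  exact_mod_cast EReal.coe_lt_top ((k : ℝ) / 2 + 1)

/-- A cusp form of weight `k` is `O((Im τ) ^ (-k / 2 - M))` on the whole upper half-plane, for all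
`M ≥ 0`. -/
theorem exists_norm_cuspForm_le (hN : 0 < N) {M : ℝ} (hM : 0 ≤ M) :
    ∃ C : ℝ, ∀ τ : ℍ, ‖f τ‖ ≤ C * τ.im ^ (-(k : ℝ) / 2 - M) := by
  have := isArithmetic_Gamma0GL hN
  obtain ⟨C₁, hC₁⟩ := CuspFormClass.exists_bound f
  have hdecay := CuspFormClass.exp_decay_atImInfty f one_pos (one_mem_strictPeriods_Gamma0GL N)
  have him : Tendsto UpperHalfPlane.im atImInfty atTop := tendsto_comap
  have hexp := ((isLittleO_exp_neg_mul_rpow_atTop (a := 2 * Real.pi) (by positivity)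
    (-(k : ℝ) / 2 - M)).comp_tendsto him).isBigO
  have hdecay' : f =O[atImInfty] fun τ ↦ Real.exp (-(2 * Real.pi) * τ.im) := by
    simpa using hdecay
  obtain ⟨C₂, hC₂0, hC₂⟩ := (hdecay'.trans hexp).exists_pos
  rw [Asymptotics.isBigOWith_iff] at hC₂
  obtain ⟨A, hA⟩ := (atImInfty_mem _).1 hC₂
  have hC₁0 : 0 ≤ C₁ := by
    have := (norm_nonneg _).trans (hC₁ UpperHalfPlane.I)
    simpa using this
  set R := max A 1
  have hR : 0 < R := lt_max_of_lt_right one_pos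
  refine ⟨max (C₁ * R ^ M) C₂, fun τ ↦ ?_⟩
  have hτ := τ.im_pos
  have hpos : 0 < τ.im ^ (-(k : ℝ) / 2 - M) := by positivity
  -- High up, exponential decay beats any power; below height R the bound Im(τ)^{-k/2} suffices,
  -- since (R / Im τ)^M ≥ 1.
  rcases le_total R τ.im with h | h
  · have := hA τ ((le_max_left _ _).trans h)
    simp only [mem_ofPred_eq, Function.comp_apply, Real.norm_of_nonneg hpos.le] at this
    exact this.trans (by gcongr; exact le_max_right _ _)
  · refine (hC₁ τ).trans ?_
    have h1 : 1 ≤ R ^ M * τ.im ^ (-M) := by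
      rw [Real.rpow_neg hτ.le, ← div_eq_mul_inv, one_le_div (by positivity)]
      gcongr
    calc C₁ / τ.im ^ ((k : ℝ) / 2) = C₁ * τ.im ^ (-(k : ℝ) / 2) * 1 := by
          rw [neg_div, Real.rpow_neg hτ.le, div_eq_mul_inv, mul_one]
      _ ≤ C₁ * τ.im ^ (-(k : ℝ) / 2) * (R ^ M * τ.im ^ (-M)) := by gcongr
      _ = (C₁ * R ^ M) * τ.im ^ (-(k : ℝ) / 2 - M) := by
          rw [sub_eq_add_neg (-(k : ℝ) / 2), Real.rpow_add hτ]; ring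
      _ ≤ _ := by gcongr; exact le_max_left _ _

theorem cuspForm_eq_conj {η : ℝ} (hη : ∀ n, starRingEnd ℂ (cuspFourierCoeff f n) =
      η * cuspFourierCoeff f n) {τ τ' : ℍ} (hτ : (τ' : ℂ) = -starRingEnd ℂ (τ : ℂ)) :
    starRingEnd ℂ (f τ) = η * f τ' := by
  have h1 := (hasSum_cuspFourierCoeff f τ).map (starRingEnd ℂ) continuous_conj
  have h2 := (hasSum_cuspFourierCoeff f τ').mul_left (η : ℂ)
  refine h1.unique (h2.congr_fun fun n ↦ ?_)
  simp only [Function.comp_apply, map_mul, hη, ← exp_conj, hτ, conj_I, conj_ofReal, conj_natCast,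
    show starRingEnd ℂ 2 = 2 from conj_ofNat 2]
  ring_nf

theorem cuspForm_apply_of_coe_eq {p q b : ℤ} (hNq : (N : ℤ) ∣ q) (hdet : p * p - b * q = 1)
    {τ τ' : ℍ} (hτ : (τ' : ℂ) = (p * τ + b) / (q * τ + p)) :
    f τ' = (q * τ + p : ℂ) ^ k * f τ := by
  let γ : SL(2, ℤ) := ⟨!![p, b; q, p], by rw [det_fin_two_of]; exact hdet⟩
  have hγ : γ ∈ CongruenceSubgroup.Gamma0 N :=
    CongruenceSubgroup.Gamma0_mem.2 ((ZMod.intCast_zmod_eq_zero_iff_dvd _ _).2 hNq)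
  have hf := congr_fun (SlashInvariantForm.slash_action_eqn f (γ : GL (Fin 2) ℝ)
    (Subgroup.mem_map_of_mem _ hγ)) τ
  rw [← ModularForm.SL_slash, ModularForm.slash_action_eq'_iff] at hf
  have : γ • τ = τ' := by
    ext
    rw [hτ, coe_specialLinearGroup_apply]
    simp [γ]
  rw [this] at hf
  simpa [γ] using hf

end CuspForm

/-- The restriction of a function on the upper half-plane to the vertical half-plane above the
rational number `p / q`, in the coordinate `w` with `z = (p + i w) / q`. -/
noncomputable def halfPlaneRestriction (f : ℍ → ℂ) (p q : ℤ) (w : ℂ) : ℂ :=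
  f (ofComplex ((p + I * w) / q))

section HalfPlane

variable {N : ℕ} {k : ℤ} (f : CuspForm (Gamma0GL N) k) {p q : ℤ}

theorem im_halfPlane (q p : ℤ) (w : ℂ) : ((p + I * w) / q : ℂ).im = w.re / q := by
  rw [← ofReal_intCast q, div_ofReal_im]; simp

theorem im_halfPlane_pos (hq : 0 < q) (p : ℤ) {w : ℂ} (hw : 0 < w.re) :
    0 < ((p + I * w) / q : ℂ).im := by
  have hq' : (0 : ℝ) < q := by exact_mod_cast hq
  rw [im_halfPlane]
  positivity

theorem hasSum_halfPlaneRestriction (hq : 0 < q) {w : ℂ} (hw : 0 < w.re) :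
    HasSum (fun n : ℕ ↦ twistedCoeff f ((p : ℚ) / (q : ℚ)) n *
      exp (-((2 * Real.pi / q : ℝ) * n * w))) (halfPlaneRestriction f p q w) := by
  have hq' : (q : ℂ) ≠ 0 := by exact_mod_cast hq.ne'
  refine (hasSum_cuspFourierCoeff f _).congr_fun fun n ↦ ?_
  rw [twistedCoeff, mul_assoc, ← exp_add, ofComplex_apply_of_im_pos (im_halfPlane_pos hq p hw)]
  congr 2
  push_cast
  field_simp
  ring_nf
  simp
  ring

/-- With qm = p² - 1, the matrix (p, m; q, p) sends (-p + iw)/q to (p + i/w)/q with automorphy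
factor iw. The reflection τ ↦ -τ̄ then trades -p for p, at the price of complex conjugation and η.
-/
theorem halfPlaneRestriction_inv (hNq : (N : ℤ) ∣ q) (hq : 0 < q) (hpq : p ^ 2 ≡ 1 [ZMOD q])
    {η : ℝ} (hη : ∀ n, starRingEnd ℂ (cuspFourierCoeff f n) = η * cuspFourierCoeff f n)
    (hη2 : η * η = 1) {w : ℂ} (hw : 0 < w.re) :
    halfPlaneRestriction f p q w⁻¹ =
      (I * w) ^ k * (η * starRingEnd ℂ (halfPlaneRestriction f p q (starRingEnd ℂ w))) := by
  obtain ⟨m, hm⟩ := hpq.symm.dvd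
  have hq' : (q : ℂ) ≠ 0 := by exact_mod_cast hq.ne'
  have hw0 : w ≠ 0 := by rintro rfl; simp at hw
  have hwi : 0 < (w⁻¹).re := by rw [inv_re]; exact div_pos hw (normSq_pos.2 hw0)
  have hwc : 0 < (starRingEnd ℂ w).re := by simpa using hw
  have hpmq : (p : ℂ) ^ 2 - 1 = q * m := by exact_mod_cast hm
  have h1 := cuspForm_apply_of_coe_eq f (b := m) hNq (p := p) (by linarith)
    (τ := ⟨_, im_halfPlane_pos hq (-p) hw⟩) (τ' := ⟨_, im_halfPlane_pos hq p hwi⟩) (by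
      have : (q * (((-p : ℤ) + I * w) / q) + p : ℂ) = I * w := by
        push_cast; field_simp; ring
      simp only [this]
      push_cast
      field_simp
      linear_combination hpmq + I_sq)
  have h2 := cuspForm_eq_conj f hη (τ := ⟨_, im_halfPlane_pos hq p hwc⟩)
    (τ' := ⟨_, im_halfPlane_pos hq (-p) hw⟩) (by
      simp
      ring)
  rw [halfPlaneRestriction, halfPlaneRestriction, ofComplex_apply_of_im_pos (im_halfPlane_pos hq p hwi),
    ofComplex_apply_of_im_pos (im_halfPlane_pos hq p hwc), h1, h2, ← mul_assoc (η : ℂ),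
    ← ofReal_mul, hη2, ofReal_one, one_mul]
  congr 2
  push_cast
  field_simp
  ring

theorem cuspidalOnHalfPlane_halfPlaneRestriction (hN : 0 < N) (hNq : (N : ℤ) ∣ q) (hq : 0 < q)
    (hpq : p ^ 2 ≡ 1 [ZMOD q]) {η : ℝ}
    (hη : ∀ n, starRingEnd ℂ (cuspFourierCoeff f n) = η * cuspFourierCoeff f n)
    (hη2 : η * η = 1) : CuspidalOnHalfPlane k (halfPlaneRestriction f p q) where
  continuousOn := by
    have h := (UpperHalfPlane.mdifferentiable_iff.1 (CuspFormClass.holo f)).continuousOn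
    exact h.comp (f := fun w : ℂ ↦ ((p + I * w) / q : ℂ)) (by fun_prop)
      fun w hw ↦ im_halfPlane_pos hq p hw
  bound M hM := by
    obtain ⟨C, hC⟩ := exists_norm_cuspForm_le f hN hM
    have hq' : (0 : ℝ) < q := by exact_mod_cast hq
    refine ⟨C * ((q : ℝ) ^ (-(k : ℝ) / 2 - M))⁻¹, fun w hw ↦ ?_⟩
    have h := hC ⟨_, im_halfPlane_pos hq p hw⟩
    have him : UpperHalfPlane.im ⟨_, im_halfPlane_pos hq p hw⟩ = w.re / q := im_halfPlane q p w
    rw [him, Real.div_rpow hw.le hq'.le] at h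
    rw [halfPlaneRestriction, ofComplex_apply_of_im_pos (im_halfPlane_pos hq p hw)]
    refine h.trans_eq ?_
    ring
  norm_inv w hw := by
    have hη1 : |η| = 1 := by
      rcases mul_self_eq_one_iff.1 hη2 with rfl | rfl <;> simp
    rw [halfPlaneRestriction_inv f hNq hq hpq hη hη2 hw]
    simp [hη1]

end HalfPlane

theorem exists_conj_eq_mul {a : ℕ → ℂ} (ha : (∀ n, (a n).im = 0) ∨ (∀ n, (a n).re = 0)) :
    ∃ η : ℝ, η * η = 1 ∧ ∀ n, starRingEnd ℂ (a n) = η * a n := by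
  rcases ha with ha | ha
  · exact ⟨1, by simp, fun n ↦ by simp [Complex.ext_iff, ha]⟩
  · exact ⟨-1, by simp, fun n ↦ by simp [Complex.ext_iff, ha]⟩

theorem IsEntireContinuation.eq_zero {a L : _} (hL : IsEntireContinuation a L)
    (ha : ∀ n, a n = 0) : L = 0 := by
  obtain ⟨x, hx, -⟩ := EReal.lt_iff_exists_real_btwn.1 hL.abscissa_lt_top
  refine hL.differentiable.eq_of_eqOn_halfPlane (differentiable_const 0) (x := x) fun s hs ↦ ?_
  rw [hL.eq_LSeries s (hx.trans (by exact_mod_cast hs)), funext ha]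
  exact congrFun LSeries_zero s

/-- For positive denominator, the number of zeros up to height `T` of
`L_{p/q}(s, f)` on the critical line is at least of order `T`. -/
theorem twistedLFunction_zeros_of_pos {N : ℕ} (hN : 0 < N) {p q : ℤ} (hq : 0 < q)
    (hcusp : IsGamma0EquivInfty N ((p : ℚ) / (q : ℚ))) (hpq : p ^ 2 ≡ 1 [ZMOD q])
    {k : ℤ} (f : CuspForm (Gamma0GL N) k)
    (hf : (∀ n : ℕ, (cuspFourierCoeff f n).im = 0) ∨ (∀ n : ℕ, (cuspFourierCoeff f n).re = 0)) :
    IsEntireContinuation (twistedCoeff f ((p : ℚ) / (q : ℚ)))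
        (twistedLFunction f ((p : ℚ) / (q : ℚ))) ∧
      ∃ d : ℝ, 0 < d ∧
        ENNReal.ofReal d < Filter.liminf
          (fun T : ℝ => (criticalZeroCount f ((p : ℚ) / (q : ℚ)) T : ENNReal) / ENNReal.ofReal T)
          Filter.atTop := by
  obtain ⟨η, hη2, hη⟩ := exists_conj_eq_mul hf
  have hNq := hcusp.dvd hq.ne' hpq
  have hq' : (0 : ℝ) < q := by exact_mod_cast hq
  have hc := cuspidalOnHalfPlane_halfPlaneRestriction f hN hNq hq hpq hη hη2
  have ha0 := twistedCoeff_zero f ((p : ℚ) / (q : ℚ))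
  have habs := abscissaOfAbsConv_twistedCoeff_lt_top f hN ((p : ℚ) / (q : ℚ))
  have hl : 0 < 2 * Real.pi / q := by positivity
  have hF (w : ℂ) (hw : 0 < w.re) := hasSum_halfPlaneRestriction f (p := p) hq hw
  have hex := exists_isEntireContinuation hc ha0 hl hF habs
  set x : ℚ := (p : ℚ) / (q : ℚ)
  have hL : IsEntireContinuation (twistedCoeff f x) (twistedLFunction f x) := by
    rw [twistedLFunction, dif_pos hex]
    exact hex.choose_spec
  refine ⟨hL, ?_⟩
  have hcast (t : ℝ) : (k : ℂ) / 2 + t * I = (((k : ℝ) / 2 : ℝ) : ℂ) + t * I := by push_cast; rfl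
  simp only [criticalZeroCount, hcast]
  by_cases hne : ∃ n, twistedCoeff f x n ≠ 0
  · have hFE (y : ℝ) (hy : 0 < y) : halfPlaneRestriction f p q (y⁻¹ : ℝ) =
        (η * I ^ k) * (y ^ (k : ℝ) : ℝ) * starRingEnd ℂ (halfPlaneRestriction f p q y) := by
      have := halfPlaneRestriction_inv f hNq hq hpq hη hη2 (w := y) (by simpa using hy)
      rw [conj_ofReal] at this
      rw [ofReal_inv, this, mul_zpow, Real.rpow_intCast, ofReal_zpow]
      ring
    have hε : ‖(η * I ^ k : ℂ)‖ = 1 := by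
      rcases mul_self_eq_one_iff.1 hη2 with rfl | rfl <;> simp
    obtain ⟨n, hn, han, σ₀, hσ₀, h⟩ := exists_norm_mul_sub_le ha0 hne habs
    obtain ⟨h, hh, hvol⟩ := volume_zeroFree_le hL.differentiable
      (fun B ↦ setIntegral_norm_sq_le hc ha0 hl hF hL B)
      (exists_real_function_bounds hc ha0 hl hF hL hε hFE)
      ⟨n, hn, _, han, σ₀, fun σ hσ u ↦ by
        rw [hL.eq_LSeries _ (by simpa using hσ₀.trans_le (by exact_mod_cast hσ))]
        exact h σ hσ u⟩
    exact exists_lt_liminf_of_zeroFree hh hvol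
  -- All twisted coefficients vanish, so L = 0, every t is a zero and the count is infinite for T >
  -- 0.
  · push Not at hne
    rw [hL.eq_zero hne]
    refine ⟨1, one_pos, ?_⟩
    have : ∀ᶠ T : ℝ in atTop, (⊤ : ENNReal) ≤ (({t : ℝ | 0 ≤ t ∧ t ≤ T ∧
        (0 : ℂ → ℂ) (((k : ℝ) / 2 : ℝ) + t * I) = 0}.encard : ℕ∞) : ENNReal) /
          ENNReal.ofReal T := by
      filter_upwards [eventually_gt_atTop 0] with T hT
      have : {t : ℝ | 0 ≤ t ∧ t ≤ T ∧ (0 : ℂ → ℂ) (((k : ℝ) / 2 : ℝ) + t * I) = 0} = Icc 0 T := by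
        ext t; simp
      rw [this, Set.Infinite.encard_eq (Icc_infinite hT), ENat.toENNReal_top,
        ENNReal.top_div_of_ne_top ENNReal.ofReal_ne_top]
    exact lt_of_lt_of_le ENNReal.ofReal_lt_top (le_liminf_of_le (by isBoundedDefault) this)

end CuspFormLFunction

theorem mainTheorem6 (N : ℕ) (hN : 0 < N) (p q : ℤ) (hq : q ≠ 0)
    (hcusp : IsGamma0EquivInfty N ((p : ℚ) / (q : ℚ))) (hpq : p ^ 2 ≡ 1 [ZMOD q])
    (k : ℤ) (f : CuspForm (Gamma0GL N) k)
    (hf : (∀ n : ℕ, (cuspFourierCoeff f n).im = 0) ∨ (∀ n : ℕ, (cuspFourierCoeff f n).re = 0)) :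
    IsEntireContinuation (twistedCoeff f ((p : ℚ) / (q : ℚ)))
        (twistedLFunction f ((p : ℚ) / (q : ℚ))) ∧
      ∃ d : ℝ, 0 < d ∧
        ENNReal.ofReal d < Filter.liminf
          (fun T : ℝ => (criticalZeroCount f ((p : ℚ) / (q : ℚ)) T : ENNReal) / ENNReal.ofReal T)
          Filter.atTop := by
  rcases hq.lt_or_gt with h | h
  -- Changing both signs preserves p/q and the congruence, and makes the denominator positive.
  · have hx : (p : ℚ) / (q : ℚ) = ((-p : ℤ) : ℚ) / ((-q : ℤ) : ℚ) := by
      push_cast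
      rw [neg_div_neg_eq]
    rw [hx] at hcusp ⊢
    exact twistedLFunction_zeros_of_pos hN (by omega) hcusp
      (by rw [neg_sq, Int.modEq_neg]; exact hpq) f hf
  · exact twistedLFunction_zeros_of_pos hN h hcusp hpq f hf
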